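/- Let $(S^2,g)$ be a real analytic Riemannian surface, i.e. a two-dimensional real analytic manifold, homeomorphic to the $2$-sphere, with a real analytic Riemannian metric $g$. Let $\eta_t$ be the Hamilton flow of $H(x,\xi)=|\xi|_g$ on the unit cosphere bundle $S^*S^2=\{|\xi|_g=1\}$; the geodesics (with unit speed) are the projections to $S^2$ of its orbits. Let $p\in S^2$ be a self-focal point: there is a time $\ell>0$ with $\eta_\ell(p,\xi)\in S^*_pS^2$ for all $\xi\in S^*_pS^2$. Let $T_p>0$ be the minimal such time (the minimum is attained), and define the first return map $\eta_p:S^*_pS^2\to S^*_pS^2$ by $\eta_{T_p}(p,\xi)=(p,\eta_p(\xi))$. Let $\mu_p$ be the arc length measure on the circle $S^*_pS^2$ given by the Euclidean metric $g_p$, and suppose that $\eta_p$ preserves a probability measure $\rho\,d\mu_p$ with $\rho\in L^1(S^*_pS^2,\mu_p)$. Then $\eta_p^2$ is the identity map. In particular, all geodesics through $p$ are smoothly closed with the common period $2T_p$: every orbit $\gamma:\mathbb R\to S^*S^2$ of $\eta_t$ that passes over $p$ satisfies $\gamma(t+2T_p)=\gamma(t)$ for all $t\in\mathbb R$, and its projection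 to $S^2$ is a smooth curve. (The number $2T_p$ is a common period, not necessarily the least one.) -/

import Mathlib

open scoped Manifold ContDiff Bundle
open Bundle MeasureTheory

noncomputable section

/-- The model space of a surface. -/
abbrev Plane : Type := EuclideanSpace ℝ (Fin 2)

section Surface

variable {M : Type*} [TopologicalSpace M] [ChartedSpace Plane M] [IsManifold (𝓡 2) ω M]
  [RiemannianBundle (fun x : M ↦ TangentSpace (𝓡 2) x)]

/-- The cotangent space `T*ₓM`, the dual of `TₓM`. -/
def CotangentSpace (x : M) : Type := TangentSpace (𝓡 2) x →L[ℝ] ℝ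

/-- `T*ₓM` carries the operator norm, i.e. the norm `‖ξ‖ = |ξ|_g` that is dual to the Riemannian
norm of `TₓM`. -/
instance CotangentSpace.instNormedAddCommGroup (x : M) :
    NormedAddCommGroup (CotangentSpace x) :=
  inferInstanceAs (NormedAddCommGroup (TangentSpace (𝓡 2) x →L[ℝ] ℝ))

instance CotangentSpace.instNormedSpace (x : M) :
    NormedSpace ℝ (CotangentSpace x) :=
  inferInstanceAs (NormedSpace ℝ (TangentSpace (𝓡 2) x →L[ℝ] ℝ))

instance CotangentSpace.instMeasurableSpace (x : M) :
    MeasurableSpace (CotangentSpace x) := borel _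

instance CotangentSpace.instBorelSpace (x : M) :
    BorelSpace (CotangentSpace x) := ⟨rfl⟩

/-- A continuous linear form on `TₓM`, as an element of `T*ₓM`. -/
def CotangentSpace.ofForm {x : M} (α : TangentSpace (𝓡 2) x →L[ℝ] ℝ) : CotangentSpace x := α

/-- An element of `T*ₓM`, as a continuous linear form on `TₓM`. -/
def CotangentSpace.toForm {x : M} (ξ : CotangentSpace x) : TangentSpace (𝓡 2) x →L[ℝ] ℝ := ξ

variable (M) in
/-- The points `(x, ξ)` of the cotangent bundle `T*M`. -/
abbrev CotangentPoint : Type _ :=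
  Bundle.TotalSpace (Plane →L[ℝ] ℝ) (fun x : M ↦ CotangentSpace x)

/-- The differential of a chart at `x`. -/
def chartDifferential (φ : OpenPartialHomeomorph M Plane) (x : M) :
    TangentSpace (𝓡 2) x →L[ℝ] Plane :=
  mfderiv (𝓡 2) (𝓡 2) φ x

/-- The Hamiltonian `H(x, ξ) = |ξ|_g` in the coordinates `(y, q)` of `T*M` that are induced by the
chart `φ`: here `x = φ⁻¹(y)` and `ξ = q ∘ dφₓ`. -/
def chartHamiltonian (φ : OpenPartialHomeomorph M Plane) (y : Plane) (q : Plane →L[ℝ] ℝ) : ℝ :=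
  ‖CotangentSpace.ofForm (q.comp (chartDifferential φ (φ.symm y)))‖

/-- The fibre coordinate `q = ξ ∘ (dφₓ)⁻¹` of `(x, ξ)` in the chart `φ`. -/
def chartMomentum (φ : OpenPartialHomeomorph M Plane) (z : CotangentPoint M) : Plane →L[ℝ] ℝ :=
  z.snd.toForm.comp (chartDifferential φ z.proj).inverse

/-- `γ : ℝ → S*M` is an orbit of the Hamilton flow of `H(x, ξ) = |ξ|_g` on the unit cosphere bundle
`S*M`: in the coordinates `(y, q)` of `T*M` induced by any chart of the real analytic structure it
satisfies Hamilton's equations `y' = ∂H/∂q`, `q' = -∂H/∂y`.  (Since `y'` is a vector and `∂H/∂q` is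
a functional on covectors, the first equation is tested against all covectors.) -/
structure IsUnitHamiltonOrbit (γ : ℝ → CotangentPoint M) : Prop where
  continuous_proj : Continuous fun t ↦ (γ t).proj
  norm_eq_one : ∀ t, ‖(γ t).snd‖ = 1
  hamilton : ∀ φ ∈ IsManifold.maximalAtlas (𝓡 2) ω M, ∀ t, (γ t).proj ∈ φ.source →
    (∃ v : Plane, HasDerivAt (fun s ↦ φ (γ s).proj) v t ∧
      ∀ r : Plane →L[ℝ] ℝ,
        r v = fderiv ℝ (fun q ↦ chartHamiltonian φ (φ (γ t).proj) q) (chartMomentum φ (γ t)) r) ∧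
    HasDerivAt (fun s ↦ chartMomentum φ (γ s))
      (-fderiv ℝ (fun y ↦ chartHamiltonian φ y (chartMomentum φ (γ t))) (φ (γ t).proj)) t

/-- The unit cosphere `S*ₚM`. -/
abbrev UnitCosphere (p : M) : Type := Metric.sphere (0 : CotangentSpace p) 1

/-- The measure `μₚ` on `S*ₚM` induced by the Euclidean metric `gₚ`: arc length. -/
def cosphereMeasure (p : M) : Measure (UnitCosphere p) := μH[1]

/-- `η_t(p, ξ) = (p, ζ)`, where `η_t` is the Hamilton flow of `|ξ|_g`. -/
def FlowsBack (p : M) (t : ℝ) (ξ ζ : UnitCosphere p) : Prop :=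
  ∃ γ : ℝ → CotangentPoint M, IsUnitHamiltonOrbit γ ∧
    γ 0 = ⟨p, (ξ : CotangentSpace p)⟩ ∧ γ t = ⟨p, (ζ : CotangentSpace p)⟩

/-- The times `ℓ > 0` with `η_ℓ(p, ξ) ∈ S*ₚM` for all `ξ ∈ S*ₚM`. -/
def returnTimes (p : M) : Set ℝ :=
  {ℓ | 0 < ℓ ∧ ∀ ξ : UnitCosphere p, ∃ ζ : UnitCosphere p, FlowsBack p ℓ ξ ζ}

/-- `p` is a self-focal point. -/
def IsSelfFocal (p : M) : Prop := (returnTimes p).Nonempty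

/-- The first return time `Tₚ`. -/
def firstReturnTime (p : M) : ℝ := sInf (returnTimes p)

open Classical in
/-- The first return map `ηₚ : S*ₚM → S*ₚM`, given by `η_{Tₚ}(p, ξ) = (p, ηₚ(ξ))`
(with a default value where this does not determine it; this never happens at a self-focal point
of a closed surface). -/
def firstReturnMap (p : M) (ξ : UnitCosphere p) : UnitCosphere p :=
  if h : ∃ ζ, FlowsBack p (firstReturnTime p) ξ ζ then h.choose else ξ

/-- `f` preserves a probability measure `ρ dμₚ` with `ρ ∈ L¹(S*ₚM, μₚ)`. -/
def PreservesL1Probability (p : M) (f : UnitCosphere p → UnitCosphere p) : Prop :=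
  ∃ ρ : UnitCosphere p → ℝ, (∀ ξ, 0 ≤ ρ ξ) ∧ Integrable ρ (cosphereMeasure p) ∧
    ∫ ξ, ρ ξ ∂(cosphereMeasure p) = 1 ∧
    MeasurePreserving f ((cosphereMeasure p).withDensity fun ξ ↦ ENNReal.ofReal (ρ ξ))
      ((cosphereMeasure p).withDensity fun ξ ↦ ENNReal.ofReal (ρ ξ))

end Surface

end

/-! The first return map `f` is analytic, because the Hamiltonian vector field is analytic and so is
its flow. It is also reversible: running an orbit backwards and reversing its covectors gives an
orbit, since `H` is even in `ξ`; hence `f (-f ξ) = -ξ`.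

Reversibility alone restricts the dynamics on the circle. The degree of `f` is `1` or `-1`, `f` is
injective, and `f ∘ f` has a fixed point (`exists_monotone_lift_sq`). A monotone lift of `f ∘ f`
with a fixed point has only convergent orbits, so each recurrent point of `f ∘ f` is fixed
(`circle_sq_fixed_of_recurrent`). By Poincaré recurrence the invariant probability measure gives
full mass to the recurrent points, hence to the fixed points of `f ∘ f`. If `f ∘ f` were not the
identity, the fixed points would be zeros of a non-zero analytic function, hence countable and null
for arc length and for any measure with a density: a contradiction
(`sq_eq_id_of_preservesL1Probability`).

The analytic input is `AnalyticAt.exists_analytic_flow`, an implicit function argument in a Banach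
space of paths; `isAnalyticCurveAt_flow` carries it from charts to arbitrary times. Periodicity
follows from `f ∘ f = id` by uniqueness of orbits (`IsUnitHamiltonOrbit.eq_of_eq_at`). -/

set_option linter.unusedSectionVars false

/-! ### Superposition operators on spaces of continuous functions. -/

noncomputable section

open Set Filter Topology

section Superposition

variable {K : Type*} [TopologicalSpace K] [CompactSpace K]
  {E : Type*} [NormedAddCommGroup E] [NormedSpace ℝ E]
  {F : Type*} [NormedAddCommGroup F] [NormedSpace ℝ F]

/-- The pointwise action of a continuous multilinear map on continuous functions. -/
def ContinuousMultilinearMap.pointwise {n : ℕ} (f : E [×n]→L[ℝ] F) :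
    C(K, E) [×n]→L[ℝ] C(K, F) :=
  MultilinearMap.mkContinuous
    { toFun := fun b ↦ ⟨fun s ↦ f fun i ↦ b i s, by fun_prop⟩
      map_update_add' := by
        intro _ m i x y
        ext s
        have h : ∀ w : C(K, E), (fun j ↦ (Function.update m i w) j s)
            = Function.update (fun j ↦ m j s) i (w s) := by
          intro w
          ext j
          by_cases hj : j = i
          · subst hj; simp
          · simp [hj]
        simp only [ContinuousMap.coe_mk, ContinuousMap.add_apply, h]
        exact f.map_update_add _ _ _ _
      map_update_smul' := by
        intro _ m i c x
        ext s
        have h : ∀ w : C(K, E), (fun j ↦ (Function.update m i w) j s)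
            = Function.update (fun j ↦ m j s) i (w s) := by
          intro w
          ext j
          by_cases hj : j = i
          · subst hj; simp
          · simp [hj]
        simp only [ContinuousMap.coe_mk, ContinuousMap.smul_apply, h]
        exact f.map_update_smul _ _ _ _ }
    ‖f‖ (by
      intro m
      refine (ContinuousMap.norm_le _ (by positivity)).2 fun s ↦ ?_
      refine (f.le_opNorm _).trans ?_
      gcongr with i
      exact ContinuousMap.norm_coe_le_norm _ _)

lemma ContinuousMultilinearMap.norm_pointwise_le {n : ℕ} (f : E [×n]→L[ℝ] F) :
    ‖(f.pointwise : C(K, E) [×n]→L[ℝ] C(K, F))‖ ≤ ‖f‖ :=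
  MultilinearMap.mkContinuous_norm_le _ (norm_nonneg _) _

/-- Near a constant map, the superposition operator `α ↦ X ∘ α` of an analytic map `X` is
analytic. -/
theorem AnalyticAt.exists_superposition [CompleteSpace F] {X : E → F} {z : E}
    (hX : AnalyticAt ℝ X z) :
    ∃ N : C(K, E) → C(K, F), AnalyticAt ℝ N (ContinuousMap.const K z) ∧
      ∀ᶠ α in 𝓝 (ContinuousMap.const K z), ∀ s, N α s = X (α s) := by
  obtain ⟨p, r, hp⟩ := hX
  let P : FormalMultilinearSeries ℝ C(K, E) C(K, F) := fun n ↦ (p n).pointwise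
  -- The pointwise action does not increase norms, so the lifted series converges on a ball at least
  -- as large.
  have hrad : r ≤ P.radius := by
    refine hp.r_le.trans ?_
    refine ENNReal.le_of_forall_nnreal_lt fun ρ hρ ↦ ?_
    obtain ⟨C, -, hC⟩ := p.norm_mul_pow_le_of_lt_radius hρ
    refine P.le_radius_of_bound C fun n ↦ (mul_le_mul_of_nonneg_right
      (p n).norm_pointwise_le (by positivity)).trans (hC n)
  have hPpos : 0 < P.radius := hp.r_pos.trans_le hrad
  refine ⟨fun α ↦ P.sum (α - ContinuousMap.const K z), ?_, ?_⟩
  · have h0 : AnalyticAt ℝ P.sum (ContinuousMap.const K z - ContinuousMap.const K z) := by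
      rw [sub_self]
      exact (P.hasFPowerSeriesOnBall hPpos).analyticAt
    exact h0.comp_of_eq (analyticAt_id.sub analyticAt_const) rfl
  · have hball : Metric.eball (ContinuousMap.const K z) r ∈ 𝓝 (ContinuousMap.const K z) :=
      Metric.eball_mem_nhds _ hp.r_pos
    filter_upwards [hball] with α hα s
    have hmem : α - ContinuousMap.const K z ∈ Metric.eball (0 : C(K, E)) r := by
      simpa [edist_eq_enorm_sub] using hα
    have hs := P.hasSum (Metric.eball_subset_eball hrad hmem)
    -- Evaluation at `s` turns the lifted series into the series of `X` at `α s`.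
    have hs' := hs.mapL (ContinuousMap.evalCLM ℝ s)
    have hnorm : ‖α s - z‖ₑ ≤ ‖α - ContinuousMap.const K z‖ₑ := by
      rw [enorm_le_iff_norm_le]
      exact (α - ContinuousMap.const K z).norm_coe_le_norm s
    have hmem' : α s - z ∈ Metric.eball (0 : E) r := by
      have h2 : ‖α - ContinuousMap.const K z‖ₑ < r := by simpa [edist_eq_enorm_sub] using hmem
      simpa [edist_eq_enorm_sub] using hnorm.trans_lt h2
    have hX := hp.hasSum hmem'
    rw [add_sub_cancel] at hX
    exact hs'.unique hX

end Superposition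
end

/-! ### Local flows of analytic vector fields. -/

noncomputable section

open Set Filter Topology

section AnalyticFlow

variable {E : Type*} [NormedAddCommGroup E] [NormedSpace ℝ E]

/-- The continuous functions on `[-1, 1]`. -/
local notation "𝒞" => C(Icc (-1 : ℝ) 1, E)

/-- The extension of a function on `[-1, 1]` to the line, constant on both sides. -/
def extendUnit (β : C(Icc (-1 : ℝ) 1, E)) (u : ℝ) : E :=
  β (projIcc (-1) 1 (by norm_num) u)

lemma continuous_extendUnit (β : 𝒞) : Continuous (extendUnit β) :=
  β.continuous.comp continuous_projIcc

lemma extendUnit_of_mem (β : 𝒞) {u : ℝ} (hu : u ∈ Icc (-1 : ℝ) 1) : extendUnit β u = β ⟨u, hu⟩ := by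
  rw [extendUnit, projIcc_of_mem]

variable [CompleteSpace E]

variable (E) in
/-- Integration from `0`, as an operator on the continuous functions on `[-1, 1]`. -/
def integralFromZero : C(Icc (-1 : ℝ) 1, E) →L[ℝ] C(Icc (-1 : ℝ) 1, E) :=
  LinearMap.mkContinuous
    { toFun := fun β ↦ ⟨fun s ↦ ∫ u in (0 : ℝ)..s, extendUnit β u,
        (intervalIntegral.continuous_primitive
          (fun _ _ ↦ (continuous_extendUnit β).intervalIntegrable _ _) 0).comp
          continuous_subtype_val⟩
      map_add' := fun β β' ↦ by
        ext s
        exact intervalIntegral.integral_add ((continuous_extendUnit β).intervalIntegrable _ _)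
          ((continuous_extendUnit β').intervalIntegrable _ _)
      map_smul' := fun c β ↦ by
        ext s
        exact intervalIntegral.integral_smul _ _ }
    1 (fun β ↦ by
      refine (ContinuousMap.norm_le _ (by positivity)).2 fun s ↦ ?_
      have h := intervalIntegral.norm_integral_le_of_norm_le_const (a := 0) (b := (s : ℝ))
        (f := extendUnit β) (C := ‖β‖) (fun u _ ↦ β.norm_coe_le_norm _)
      have hs : |(s : ℝ) - 0| ≤ 1 := by rw [sub_zero]; exact abs_le.2 s.2
      calc _ ≤ ‖β‖ * |(s : ℝ) - 0| := h
        _ ≤ ‖β‖ * 1 := by gcongr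
        _ = 1 * ‖β‖ := mul_comm _ _)

/-- Near the constant path at `z`, the solutions on `[-1, 1]` of `α' = τ • X(α)` with
`α(0) = w` form an analytic family, with parameters `(w, τ)` near `(z, 0)`. -/
theorem AnalyticAt.exists_analytic_paths {X : E → E} {z : E} (hX : AnalyticAt ℝ X z) :
    ∃ A : E × ℝ → C(Icc (-1 : ℝ) 1, E), ContDiffAt ℝ ω A (z, 0) ∧
      A (z, 0) = ContinuousMap.const _ z ∧
      ∀ᶠ w in 𝓝 ((z, 0) : E × ℝ), ∃ β : C(Icc (-1 : ℝ) 1, E), (∀ s, β s = X (A w s)) ∧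
        A w = ContinuousMap.const _ w.1 + w.2 • integralFromZero E β := by
  obtain ⟨N, hN, hNX⟩ := hX.exists_superposition (K := Icc (-1 : ℝ) 1)
  let c : E →L[ℝ] 𝒞 := ContinuousLinearMap.const ℝ (Icc (-1 : ℝ) 1)
  have hc : ∀ v, c v = ContinuousMap.const _ v := fun v ↦ rfl
  rw [← hc] at hN hNX
  let a : (E × ℝ) × 𝒞 := ((z, 0), c z)
  -- The integral equation, with the parameters `(w, τ)` kept as the first component: inverting `G`
  -- solves it analytically in the parameters.
  let G : (E × ℝ) × 𝒞 → (E × ℝ) × 𝒞 :=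
    fun w ↦ (w.1, w.2 - c w.1.1 - w.1.2 • integralFromZero E (N w.2))
  have hNa : ContDiffAt ℝ ω (fun w : (E × ℝ) × 𝒞 ↦ N w.2) a :=
    ContDiffAt.comp (g := N) a hN.contDiffAt contDiffAt_snd
  have hG : ContDiffAt ℝ ω G a := by
    refine contDiffAt_fst.prodMk ((contDiffAt_snd.sub ?_).sub ?_)
    · exact (c.contDiff.contDiffAt).comp a (contDiffAt_fst.comp a contDiffAt_fst)
    · exact (contDiffAt_snd.comp a contDiffAt_fst).smul
        ((integralFromZero E).contDiff.contDiffAt.comp a hNa)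
  let c₀ : 𝒞 := integralFromZero E (N (c z))
  -- The differential at `a` of `w + τ • ∫ N(α)`. It does not involve the variation of `α` because
  -- `τ = 0` there, so the differential of `G` is triangular and is inverted by changing the sign of
  -- `P`.
  let P : (E × ℝ) × 𝒞 →L[ℝ] 𝒞 :=
    c ∘L (ContinuousLinearMap.fst ℝ E ℝ) ∘L (ContinuousLinearMap.fst ℝ (E × ℝ) 𝒞)
    + ((ContinuousLinearMap.snd ℝ E ℝ) ∘L (ContinuousLinearMap.fst ℝ (E × ℝ) 𝒞)).smulRight c₀
  have hP : ∀ w, P w = c w.1.1 + w.1.2 • c₀ := fun w ↦ rfl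
  let D : ((E × ℝ) × 𝒞) ≃L[ℝ] ((E × ℝ) × 𝒞) :=
    ContinuousLinearEquiv.equivOfInverse
      ((ContinuousLinearMap.fst ℝ (E × ℝ) 𝒞).prod (ContinuousLinearMap.snd ℝ (E × ℝ) 𝒞 - P))
      ((ContinuousLinearMap.fst ℝ (E × ℝ) 𝒞).prod (ContinuousLinearMap.snd ℝ (E × ℝ) 𝒞 + P))
      (fun w ↦ by
        refine Prod.ext rfl ?_
        simp [hP])
      (fun w ↦ by
        refine Prod.ext rfl ?_
        simp [hP])
  have hD : HasFDerivAt G (D : ((E × ℝ) × 𝒞) →L[ℝ] ((E × ℝ) × 𝒞)) a := by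
    have h1 : HasFDerivAt (fun w : (E × ℝ) × 𝒞 ↦ w.1)
        (ContinuousLinearMap.fst ℝ (E × ℝ) 𝒞) a := hasFDerivAt_fst
    have h2 : HasFDerivAt (fun w : (E × ℝ) × 𝒞 ↦ w.2)
        (ContinuousLinearMap.snd ℝ (E × ℝ) 𝒞) a := hasFDerivAt_snd
    have h3 : HasFDerivAt (fun w : (E × ℝ) × 𝒞 ↦ c w.1.1)
        (c ∘L (ContinuousLinearMap.fst ℝ E ℝ) ∘L (ContinuousLinearMap.fst ℝ (E × ℝ) 𝒞)) a :=
      (c ∘L (ContinuousLinearMap.fst ℝ E ℝ) ∘L (ContinuousLinearMap.fst ℝ (E × ℝ) 𝒞)).hasFDerivAt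
    have h4 : HasFDerivAt (fun w : (E × ℝ) × 𝒞 ↦ w.1.2)
        ((ContinuousLinearMap.snd ℝ E ℝ) ∘L (ContinuousLinearMap.fst ℝ (E × ℝ) 𝒞)) a :=
      ((ContinuousLinearMap.snd ℝ E ℝ) ∘L (ContinuousLinearMap.fst ℝ (E × ℝ) 𝒞)).hasFDerivAt
    have h5 : DifferentiableAt ℝ (fun w : (E × ℝ) × 𝒞 ↦ integralFromZero E (N w.2)) a :=
      ((integralFromZero E).contDiff.contDiffAt.comp a hNa).differentiableAt (by simp)
    have h6 := h1.prodMk ((h2.sub h3).sub (h4.smul h5.hasFDerivAt))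
    refine h6.congr_fderiv ?_
    refine ContinuousLinearMap.ext fun w ↦ Prod.ext rfl ?_
    simp [D, P, a, c₀]
    abel
  have hn : (ω : WithTop ℕ∞) ≠ 0 := by simp
  have hGa : G a = ((z, 0), 0) := by simp [G, a]
  let J := hG.localInverse hD hn
  have hJ : ContDiffAt ℝ ω J ((z, 0), 0) := hGa ▸ hG.to_localInverse hD hn
  have hJa : J ((z, 0), 0) = a := hGa ▸ hG.localInverse_apply_image hD hn
  have hGJ : ∀ᶠ w in 𝓝 (((z, 0), 0) : (E × ℝ) × 𝒞), G (J w) = w :=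
    hGa ▸ (hG.hasStrictFDerivAt' hD hn).eventually_right_inverse
  let ι : E × ℝ → (E × ℝ) × 𝒞 := fun w ↦ (w, 0)
  have hι : ContDiffAt ℝ ω ι (z, 0) := contDiffAt_id.prodMk contDiffAt_const
  have hA : ContDiffAt ℝ ω (fun w ↦ (J (ι w)).2) (z, 0) :=
    contDiffAt_snd.comp (z, 0) (ContDiffAt.comp (g := J) (z, 0) hJ hι)
  have hA0 : (J (ι (z, 0))).2 = c z := by simp only [ι]; rw [hJa]
  refine ⟨fun w ↦ (J (ι w)).2, hA, hA0, ?_⟩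
  have e1 := hι.continuousAt.eventually hGJ
  have e2 : ∀ᶠ w in 𝓝 ((z, 0) : E × ℝ), ∀ s, N (J (ι w)).2 s = X ((J (ι w)).2 s) :=
    hA.continuousAt.eventually (p := fun α : 𝒞 ↦ ∀ s, N α s = X (α s))
      (by beta_reduce; rw [hA0]; exact hNX)
  filter_upwards [e1, e2] with w hw1 hw2
  refine ⟨N (J (ι w)).2, hw2, ?_⟩
  have hfst : (J (ι w)).1 = w := congrArg Prod.fst hw1
  have hsnd : (J (ι w)).2 - c (J (ι w)).1.1
      - (J (ι w)).1.2 • integralFromZero E (N (J (ι w)).2) = 0 := congrArg Prod.snd hw1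
  rw [hfst, sub_sub, sub_eq_zero] at hsnd
  exact hsnd

/-- An analytic vector field has a local flow that is analytic in the initial value. -/
theorem AnalyticAt.exists_analytic_flow {X : E → E} {z : E} (hX : AnalyticAt ℝ X z)
    {W : Set E} (hW : W ∈ 𝓝 z) :
    ∃ ε > 0, ∃ U : Set E, IsOpen U ∧ z ∈ U ∧ ∃ Φ : ℝ → E → E, ∀ w ∈ U,
      Φ 0 w = w ∧ ∀ t ∈ Ioo (-ε) ε, HasDerivAt (fun s ↦ Φ s w) (X (Φ t w)) t ∧ Φ t w ∈ W ∧
        ContDiffAt ℝ ω (Φ t) w := by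
  obtain ⟨A, hA, hA0, hAX⟩ := hX.exists_analytic_paths
  have hev : ∀ᶠ α in 𝓝 (ContinuousMap.const (Icc (-1 : ℝ) 1) z), ∀ s, α s ∈ W := by
    obtain ⟨r, hr, hrW⟩ := Metric.mem_nhds_iff.1 hW
    filter_upwards [Metric.ball_mem_nhds _ hr] with α hα s
    exact hrW ((ContinuousMap.dist_apply_le_dist (f := α)
      (g := ContinuousMap.const (Icc (-1 : ℝ) 1) z) s).trans_lt hα)
  have h1 := hA.continuousAt.eventually (hA0 ▸ hev)
  have h2 := hA.eventually (by simp)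
  obtain ⟨S, hS, T, hT, hST⟩ := mem_nhds_prod_iff.1 (hAX.and (h1.and h2))
  obtain ⟨U, hUS, hU, hzU⟩ := mem_nhds_iff.1 hS
  obtain ⟨δ, hδ, hδT⟩ := Metric.mem_nhds_iff.1 hT
  -- Half of `δ`, so that the parameter value `τ = ε` itself lies in `T`.
  have hε : (0 : ℝ) < δ / 2 := by positivity
  set ε := δ / 2 with hεdef
  have hεT : ε ∈ T := hδT (by simp [abs_of_pos hε]; linarith)
  -- The solution of `α' = ε • X(α)` on `[-1, 1]`, run at speed `1 / ε`, solves the original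
  -- equation on `(-ε, ε)`.
  refine ⟨ε, hε, U, hU, hzU, fun t w ↦ extendUnit (A (w, ε)) (t / ε), fun w hw ↦ ?_⟩
  have hmem : ((w, ε) : E × ℝ) ∈ S ×ˢ T := ⟨hUS hw, hεT⟩
  obtain ⟨⟨β, hβ, hAβ⟩, hAW, hAc⟩ := hST hmem
  have key : ∀ s ∈ Icc (-1 : ℝ) 1,
      extendUnit (A (w, ε)) s = w + ε • ∫ u in (0 : ℝ)..s, extendUnit β u := by
    intro s hs
    rw [extendUnit_of_mem _ hs, hAβ]
    rfl
  refine ⟨by beta_reduce; rw [zero_div, key 0 (by simp)]; simp, fun t ht ↦ ?_⟩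
  have hts : t / ε ∈ Ioo (-1 : ℝ) 1 := by
    constructor
    · rw [lt_div_iff₀ hε]; linarith [ht.1]
    · rw [div_lt_iff₀ hε]; linarith [ht.2]
  refine ⟨?_, hAW _, ?_⟩
  · have d1 : HasDerivAt (fun s ↦ w + ε • ∫ u in (0 : ℝ)..s, extendUnit β u)
        (ε • extendUnit β (t / ε)) (t / ε) :=
      ((intervalIntegral.integral_hasDerivAt_right
        ((continuous_extendUnit β).intervalIntegrable _ _)
        ((continuous_extendUnit β).stronglyMeasurableAtFilter _ _)
        (continuous_extendUnit β).continuousAt).const_smul ε).const_add w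
    have d2 : HasDerivAt (extendUnit (A (w, ε))) (ε • extendUnit β (t / ε)) (t / ε) := by
      refine d1.congr_of_eventuallyEq ?_
      filter_upwards [Ioo_mem_nhds hts.1 hts.2] with s hs
      exact key s (Ioo_subset_Icc_self hs)
    have d3 : HasDerivAt (fun s : ℝ ↦ s / ε) (1 / ε) t := (hasDerivAt_id t).div_const ε
    have d4 := d2.scomp t d3
    have : (1 / ε) • ε • extendUnit β (t / ε) = X (extendUnit (A (w, ε)) (t / ε)) := by
      rw [smul_smul, one_div, inv_mul_cancel₀ hε.ne', one_smul]
      exact hβ _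
    rw [this] at d4
    exact d4
  · have d5 : ContDiffAt ℝ ω (fun w ↦ A (w, ε)) w :=
      ContDiffAt.comp (g := A) w hAc (contDiffAt_id.prodMk contDiffAt_const)
    exact (ContinuousMap.evalCLM ℝ (projIcc (-1 : ℝ) 1 (by norm_num) (t / ε))).contDiff.contDiffAt.comp
      w d5

end AnalyticFlow
end

/-! ### Reversible maps of the circle. -/

noncomputable section

open Set Filter Topology Real

section CircleDynamics

/-- A continuous function with values in `2πℤ` is constant. -/
lemma exists_int_forall_eq_mul_two_pi {g : ℝ → ℝ} (hg : Continuous g)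
    (h : ∀ x, ∃ m : ℤ, g x = m * (2 * π)) : ∃ m : ℤ, ∀ x, g x = m * (2 * π) := by
  choose m hm using h
  have hm' : Continuous m := by
    refine Int.isClosedEmbedding_coe_real.isInducing.continuous_iff.2 ?_
    have : ((↑) : ℤ → ℝ) ∘ m = fun x ↦ g x / (2 * π) := by
      ext x
      simp only [Function.comp_apply]
      rw [hm x, mul_div_cancel_right₀ _ two_pi_pos.ne']
    rw [this]
    exact hg.div_const _
  refine ⟨m 0, fun x ↦ ?_⟩
  rw [hm x, PreconnectedSpace.constant inferInstance hm' (x := x) (y := 0)]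

/-- A continuous self-map of the circle lifts to the line. -/
lemma exists_lift_circle_map {f : Circle → Circle} (hf : Continuous f) :
    ∃ F : ℝ → ℝ, Continuous F ∧ ∀ x, Circle.exp (F x) = f (Circle.exp x) := by
  obtain ⟨e, he⟩ : ∃ e : ℝ, Circle.exp e = f (Circle.exp 0) :=
    ⟨_, Circle.exp_arg _⟩
  obtain ⟨F, ⟨-, hF⟩, -⟩ := Circle.isCoveringMap_exp.existsUnique_continuousMap_lifts
    (⟨fun x ↦ f (Circle.exp x), hf.comp Circle.exp.continuous⟩ : C(ℝ, Circle)) 0 e he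
  exact ⟨F, F.continuous, fun x ↦ congrFun hF x⟩

/-- If `f` is a continuous self-map of the circle and `f (-f z) = -z`, then `f ∘ f` has a monotone
lift with a fixed point. -/
theorem exists_monotone_lift_sq {f : Circle → Circle} (hf : Continuous f)
    (hrev : ∀ z, f (Circle.exp π * f z) = Circle.exp π * z) :
    ∃ K : ℝ → ℝ, Continuous K ∧ Monotone K ∧ (∀ x, Circle.exp (K x) = f (f (Circle.exp x))) ∧
      (∀ x, K (x + 2 * π) = K x + 2 * π) ∧ ∃ a, K a = a := by
  have hτ : 0 < 2 * π := two_pi_pos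
  obtain ⟨F, hFc, hF⟩ := exists_lift_circle_map hf
  -- `d` is the degree of `f`; `c` below records the reversibility relation on the lift.
  obtain ⟨d, hd⟩ : ∃ d : ℤ, ∀ x, F (x + 2 * π) - F x = d * (2 * π) := by
    refine exists_int_forall_eq_mul_two_pi (by fun_prop) fun x ↦ ?_
    have : Circle.exp (F (x + 2 * π)) = Circle.exp (F x) := by
      rw [hF, hF, Circle.exp_add_two_pi]
    obtain ⟨m, hm⟩ := Circle.exp_eq_exp.1 this
    exact ⟨m, by linarith⟩
  obtain ⟨c, hc⟩ : ∃ c : ℤ, ∀ x, F (F x + π) - (x + π) = c * (2 * π) := by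
    refine exists_int_forall_eq_mul_two_pi (by fun_prop) fun x ↦ ?_
    have : Circle.exp (F (F x + π)) = Circle.exp (x + π) := by
      rw [hF, add_comm, Circle.exp_add, hF, hrev, add_comm, Circle.exp_add]
    obtain ⟨m, hm⟩ := Circle.exp_eq_exp.1 this
    exact ⟨m, by linarith⟩
  have hdn : ∀ n : ℤ, ∀ x, F (x + n * (2 * π)) = F x + n * d * (2 * π) := by
    intro n
    induction n using Int.induction_on with
    | zero => simp
    | succ k ih =>
      intro x
      have h1 := hd (x + k * (2 * π))
      have h2 := ih x
      push_cast at h2 ⊢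
      rw [show x + ((k : ℝ) + 1) * (2 * π) = x + k * (2 * π) + 2 * π by ring]
      linarith
    | pred k ih =>
      intro x
      have h1 := hd (x + ((-(k : ℤ) - 1 : ℤ) : ℝ) * (2 * π))
      have h2 := ih x
      push_cast at h1 h2 ⊢
      rw [show x + (-(k : ℝ) - 1) * (2 * π) + 2 * π = x + -(k : ℝ) * (2 * π) by ring] at h1
      linarith
  have hd2 : d * d = 1 := by
    -- Translating `x` by a period changes `F (F x + π)` by `d * d` periods, and `x + π` by one.
    have h1 := hc (0 + 2 * π)
    have h0 := hc 0
    rw [show F (0 + 2 * π) + π = F 0 + π + d * (2 * π) by linarith [hd 0], hdn] at h1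
    have h3 : ((d : ℝ) * d) * (2 * π) = 1 * (2 * π) := by linarith
    exact_mod_cast mul_right_cancel₀ hτ.ne' h3
  have hinj : Function.Injective F := by
    intro x y hxy
    have hx := hc x
    have hy := hc y
    rw [hxy] at hx
    linarith
  obtain ⟨a, n, ha⟩ : ∃ a : ℝ, ∃ n : ℤ, F (F a) = a + n * (2 * π) := by
    rcases mul_self_eq_one_iff.1 hd2 with hd1 | hd1
    -- Degree `1`: if no point is fixed, the displacement of `F ∘ F` stays strictly between two
    -- consecutive multiples of `2π`.
    · by_contra! hne
      have huc : Continuous fun x ↦ F (F x) - x := by fun_prop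
      have hu : ∀ x, ∀ m : ℤ, F (F x) - x ≠ m * (2 * π) := fun x m h ↦ hne x m (by linarith)
      set k : ℤ := ⌊(F (F 0) - 0) / (2 * π)⌋ with hk
      have hk1 : k * (2 * π) ≤ F (F 0) - 0 := (le_div_iff₀ hτ).1 (Int.floor_le _)
      have hk2 : F (F 0) - 0 < (k + 1) * (2 * π) := (div_lt_iff₀ hτ).1 (Int.lt_floor_add_one _)
      have hlow : ∀ x, k * (2 * π) < F (F x) - x := by
        intro x
        by_contra! hx
        obtain ⟨y, hy⟩ := mem_range_of_exists_le_of_exists_ge huc ⟨x, hx⟩ ⟨0, hk1⟩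
        exact hu y k hy
      have hupp : ∀ x, F (F x) - x < (k + 1) * (2 * π) := by
        intro x
        by_contra! hx
        obtain ⟨y, hy⟩ := mem_range_of_exists_le_of_exists_ge huc ⟨0, hk2.le⟩ ⟨x, hx⟩
        exact hu y (k + 1) (by push_cast; exact hy)
      -- By reversibility, the displacements at `0` and at `F (F 0) + π` add up to `2c` periods.
      -- Both lie strictly between `k` and `k + 1` periods, so `k < c < k + 1`.
      have e1 : F (F (F 0) + π) = F 0 + π + c * (2 * π) := by linarith [hc (F 0)]
      have e2 : F (F (F (F 0) + π)) = 0 + π + 2 * c * (2 * π) := by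
        rw [e1, hdn, hd1]
        push_cast
        linarith [hc 0]
      have l1 := hlow 0
      have l2 := hlow (F (F 0) + π)
      have u1 := hupp 0
      have u2 := hupp (F (F 0) + π)
      rw [e2] at l2 u2
      have l3 : (k : ℝ) * (2 * π) < c * (2 * π) := by linarith
      have u3 : (c : ℝ) * (2 * π) < (k + 1) * (2 * π) := by linarith
      have l4 : (k : ℝ) < c := lt_of_mul_lt_mul_right l3 hτ.le
      have u4 : (c : ℝ) < k + 1 := lt_of_mul_lt_mul_right u3 hτ.le
      have l5 : k < c := by exact_mod_cast l4
      have u5 : c < k + 1 := by exact_mod_cast u4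
      omega
    -- Degree `-1`: `F x - x` drops by two periods whenever `x` grows by one, so it changes sign and
    -- `F` itself has a fixed point.
    · have hgc : Continuous fun x ↦ F x - x := by fun_prop
      have hg : ∀ m : ℤ, F (m * (2 * π)) - m * (2 * π) = F 0 - 2 * m * (2 * π) := by
        intro m
        have := hdn m 0
        rw [hd1] at this
        push_cast at this
        rw [zero_add] at this
        linarith
      have hge : 0 ≤ F (((-⌈|F 0| / (2 * π)⌉ : ℤ) : ℝ) * (2 * π))
          - ((-⌈|F 0| / (2 * π)⌉ : ℤ) : ℝ) * (2 * π) := by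
        rw [hg]
        have := (div_le_iff₀ hτ).1 (Int.le_ceil (|F 0| / (2 * π)))
        push_cast
        nlinarith [neg_abs_le (F 0), abs_nonneg (F 0)]
      have hle : F (((⌈|F 0| / (2 * π)⌉ : ℤ) : ℝ) * (2 * π))
          - ((⌈|F 0| / (2 * π)⌉ : ℤ) : ℝ) * (2 * π) ≤ 0 := by
        rw [hg]
        have := (div_le_iff₀ hτ).1 (Int.le_ceil (|F 0| / (2 * π)))
        nlinarith [le_abs_self (F 0), abs_nonneg (F 0)]
      obtain ⟨a, ha⟩ := mem_range_of_exists_le_of_exists_ge hgc ⟨_, hle⟩ ⟨_, hge⟩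
      have ha' : F a = a := by simpa [sub_eq_zero] using ha
      exact ⟨a, 0, by simp [ha']⟩
  have hper : ∀ x, F (F (x + 2 * π)) - n * (2 * π) = F (F x) - n * (2 * π) + 2 * π := by
    intro x
    rw [show F (x + 2 * π) = F x + d * (2 * π) by linarith [hd x], hdn]
    have : (d : ℝ) * d = 1 := by exact_mod_cast hd2
    rw [this]
    ring
  have hKc : Continuous fun x ↦ F (F x) - n * (2 * π) := by fun_prop
  refine ⟨fun x ↦ F (F x) - n * (2 * π), hKc, ?_, ?_, hper, a, by linarith⟩
  · have hKinj : Function.Injective fun x ↦ F (F x) - n * (2 * π) := fun x y hxy ↦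
      hinj (hinj (sub_left_injective hxy))
    -- An injective continuous lift is strictly monotone; the decreasing case contradicts
    -- commutation with the period.
    rcases hKc.strictMono_of_inj hKinj with h | h
    · exact h.monotone
    · have h1 := h (show a < a + 2 * π by linarith)
      have h2 := hper a
      simp only at h1
      linarith
  · intro x
    rw [← hF x, ← hF]
    exact Circle.exp_eq_exp.2 ⟨-n, by push_cast; ring⟩

/-- If `f` is a continuous self-map of the circle and `f (-f z) = -z`, then every recurrent point
of `f ∘ f` is a fixed point of `f ∘ f`. -/
theorem circle_sq_fixed_of_recurrent {f : Circle → Circle} (hf : Continuous f)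
    (hrev : ∀ z, f (Circle.exp π * f z) = Circle.exp π * z) {z : Circle}
    (hz : ∀ s ∈ 𝓝 z, ∃ᶠ n in atTop, (f ∘ f)^[n] z ∈ s) : f (f z) = z := by
  obtain ⟨K, hKc, hKm, hK, hKp, a, ha⟩ := exists_monotone_lift_sq hf hrev
  obtain ⟨x, rfl⟩ : ∃ x : ℝ, Circle.exp x = z := ⟨_, Circle.exp_arg _⟩
  have hKit : ∀ n : ℕ, Circle.exp (K^[n] x) = (f ∘ f)^[n] (Circle.exp x) := by
    intro n
    induction n with
    | zero => rfl
    | succ k ih => rw [Function.iterate_succ_apply', Function.iterate_succ_apply', hK, ih]; rfl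
  have hfixn : ∀ n : ℕ, K (a + n * (2 * π)) = a + n * (2 * π) := by
    intro n
    induction n with
    | zero => simpa using ha
    | succ k ih =>
      push_cast
      rw [show a + ((k : ℝ) + 1) * (2 * π) = a + k * (2 * π) + 2 * π by ring, hKp, ih]
  have hfixn' : ∀ n : ℕ, K (a - n * (2 * π)) = a - n * (2 * π) := by
    intro n
    induction n with
    | zero => simpa using ha
    | succ k ih =>
      push_cast
      have := hKp (a - ((k : ℝ) + 1) * (2 * π))
      rw [show a - ((k : ℝ) + 1) * (2 * π) + 2 * π = a - k * (2 * π) by ring, ih] at this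
      linarith
  -- The orbit of `x` is monotone, and the translates of the fixed point `a` are barriers on both
  -- sides of it.
  obtain ⟨y, hy⟩ : ∃ y, Tendsto (fun n ↦ K^[n] x) atTop (𝓝 y) := by
    obtain ⟨N, hN⟩ := exists_nat_ge (|x - a| / (2 * π))
    rw [div_le_iff₀ two_pi_pos] at hN
    rcases le_total x (K x) with h | h
    · refine ⟨_, tendsto_atTop_ciSup (hKm.monotone_iterate_of_le_map h)
        ⟨a + N * (2 * π), ?_⟩⟩
      rintro _ ⟨n, rfl⟩
      have := hKm.iterate n (show x ≤ a + N * (2 * π) by linarith [le_abs_self (x - a)])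
      rwa [(show Function.IsFixedPt K _ from hfixn N).iterate n] at this
    · refine ⟨_, tendsto_atTop_ciInf (hKm.antitone_iterate_of_map_le h)
        ⟨a - N * (2 * π), ?_⟩⟩
      rintro _ ⟨n, rfl⟩
      have := hKm.iterate n (show a - N * (2 * π) ≤ x by linarith [neg_abs_le (x - a)])
      rwa [(show Function.IsFixedPt K _ from hfixn' N).iterate n] at this
  have hKy : K y = y := isFixedPt_of_tendsto_iterate hy hKc.continuousAt
  have hlim : Tendsto (fun n ↦ (f ∘ f)^[n] (Circle.exp x)) atTop (𝓝 (Circle.exp y)) := by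
    simp only [← hKit]
    exact (Circle.exp.continuous.tendsto y).comp hy
  have hxy : Circle.exp x = Circle.exp y := by
    -- A recurrent orbit that converges can only converge to its starting point.
    by_contra hne
    obtain ⟨s, t, hs, ht, hst⟩ := t2_separation_nhds hne
    obtain ⟨n, hns, hnt⟩ := ((hz s hs).and_eventually (hlim.eventually ht)).exists
    exact Set.disjoint_left.1 hst hns hnt
  rw [hxy, ← hK, hKy]

end CircleDynamics
end

/-! ### The metric, the Hamiltonian and its vector field in a chart. -/

noncomputable section

open Set Filter Topology

section ChartHamiltonian

variable {M : Type*} [TopologicalSpace M] [ChartedSpace Plane M] [IsManifold (𝓡 2) ω M]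

instance (x : M) : FiniteDimensional ℝ (TangentSpace (𝓡 2) x) :=
  inferInstanceAs (FiniteDimensional ℝ Plane)

lemma mdifferentiable_of_mem_maximalAtlas {φ : OpenPartialHomeomorph M Plane}
    (hφ : φ ∈ IsManifold.maximalAtlas (𝓡 2) ω M) : φ.MDifferentiable (𝓡 2) (𝓡 2) :=
  ⟨(contMDiffOn_of_mem_maximalAtlas hφ).mdifferentiableOn (by simp),
    (contMDiffOn_symm_of_mem_maximalAtlas hφ).mdifferentiableOn (by simp)⟩

/-- The differential of a chart, as an isomorphism. -/
def chartDifferentialEquiv {φ : OpenPartialHomeomorph M Plane}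
    (hφ : φ ∈ IsManifold.maximalAtlas (𝓡 2) ω M) {x : M} (hx : x ∈ φ.source) :
    TangentSpace (𝓡 2) x ≃L[ℝ] Plane :=
  (mdifferentiable_of_mem_maximalAtlas hφ).mfderiv hx

lemma coe_chartDifferentialEquiv {φ : OpenPartialHomeomorph M Plane}
    (hφ : φ ∈ IsManifold.maximalAtlas (𝓡 2) ω M) {x : M} (hx : x ∈ φ.source) :
    (chartDifferentialEquiv hφ hx : TangentSpace (𝓡 2) x →L[ℝ] Plane) = chartDifferential φ x :=
  rfl

lemma inverse_chartDifferential {φ : OpenPartialHomeomorph M Plane}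
    (hφ : φ ∈ IsManifold.maximalAtlas (𝓡 2) ω M) {x : M} (hx : x ∈ φ.source) :
    (chartDifferential φ x).inverse = (chartDifferentialEquiv hφ hx).symm := by
  rw [← coe_chartDifferentialEquiv hφ hx, ContinuousLinearMap.inverse_equiv]

lemma inverse_chartDifferential_symm {φ : OpenPartialHomeomorph M Plane}
    (hφ : φ ∈ IsManifold.maximalAtlas (𝓡 2) ω M) {y : Plane} (hy : y ∈ φ.target) :
    (chartDifferential φ (φ.symm y)).inverse = mfderiv (𝓡 2) (𝓡 2) φ.symm y := by
  rw [inverse_chartDifferential hφ (φ.map_target hy)]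
  change mfderiv (𝓡 2) (𝓡 2) φ.symm (φ (φ.symm y)) = _
  rw [φ.right_inv hy]

variable [RiemannianBundle (fun x : M ↦ TangentSpace (𝓡 2) x)]

/-- The Riemannian metric in the coordinates of a chart. -/
def chartMetric (φ : OpenPartialHomeomorph M Plane) (y : Plane) : Plane →L[ℝ] Plane →L[ℝ] ℝ :=
  (innerSL ℝ (E := TangentSpace (𝓡 2) (φ.symm y))).bilinearComp
    (chartDifferential φ (φ.symm y)).inverse (chartDifferential φ (φ.symm y)).inverse

lemma chartMetric_apply (φ : OpenPartialHomeomorph M Plane) (y v w : Plane) :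
    chartMetric φ y v w = inner ℝ ((chartDifferential φ (φ.symm y)).inverse v)
      ((chartDifferential φ (φ.symm y)).inverse w) := rfl

/-- Riesz representation: the covector `q ∘ dφ` is the inner product with a vector `u` of the same
norm, and `w` is `u` in coordinates. This raises the index of `q`. -/
lemma exists_chartMetric_eq {φ : OpenPartialHomeomorph M Plane}
    (hφ : φ ∈ IsManifold.maximalAtlas (𝓡 2) ω M) {y : Plane} (hy : y ∈ φ.target)
    (q : Plane →L[ℝ] ℝ) :
    ∃ w, chartMetric φ y w = q ∧ chartHamiltonian φ y q = √(q w) := by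
  let e := chartDifferentialEquiv hφ (φ.map_target hy)
  let α : TangentSpace (𝓡 2) (φ.symm y) →L[ℝ] ℝ := q.comp (e : _ →L[ℝ] Plane)
  have : CompleteSpace (TangentSpace (𝓡 2) (φ.symm y)) := FiniteDimensional.complete ℝ _
  let u := (InnerProductSpace.toDual ℝ (TangentSpace (𝓡 2) (φ.symm y))).symm α
  have hu : ∀ v, inner ℝ u v = α v := fun v ↦ InnerProductSpace.toDual_symm_apply
  refine ⟨e u, ?_, ?_⟩
  · ext v
    rw [chartMetric_apply, inverse_chartDifferential hφ (φ.map_target hy)]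
    change inner ℝ (e.symm (e u)) (e.symm v) = q v
    rw [e.symm_apply_apply, hu]
    change q (e (e.symm v)) = q v
    rw [e.apply_symm_apply]
  · have h1 : chartHamiltonian φ y q = ‖α‖ := rfl
    have h2 : ‖u‖ = ‖α‖ := LinearIsometryEquiv.norm_map _ _
    have h3 : q (e u) = inner ℝ u u := (hu u).symm
    rw [h1, ← h2, h3, real_inner_self_eq_norm_sq, Real.sqrt_sq (norm_nonneg _)]

lemma chartMetric_isInvertible {φ : OpenPartialHomeomorph M Plane}
    (hφ : φ ∈ IsManifold.maximalAtlas (𝓡 2) ω M) {y : Plane} (hy : y ∈ φ.target) :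
    (chartMetric φ y).IsInvertible := by
  refine ⟨ContinuousLinearEquiv.ofBijective (chartMetric φ y) ?_ ?_, by ext; rfl⟩
  · refine LinearMap.ker_eq_bot'.2 fun v hv ↦ ?_
    have h1 : chartMetric φ y v v = 0 := by
      change chartMetric φ y v = 0 at hv
      rw [hv]
      rfl
    rw [chartMetric_apply, inner_self_eq_zero, inverse_chartDifferential hφ (φ.map_target hy)] at h1
    exact (map_eq_zero_iff _ (ContinuousLinearEquiv.injective _)).1 h1
  · refine LinearMap.range_eq_top.2 fun q ↦ ?_
    obtain ⟨w, hw, -⟩ := exists_chartMetric_eq hφ hy q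
    exact ⟨w, hw⟩

/-- The classical formula with the inverse metric, which makes analyticity visible: inversion is
analytic, and so is the square root away from `0`. -/
lemma chartHamiltonian_eq_sqrt {φ : OpenPartialHomeomorph M Plane}
    (hφ : φ ∈ IsManifold.maximalAtlas (𝓡 2) ω M) {y : Plane} (hy : y ∈ φ.target)
    (q : Plane →L[ℝ] ℝ) :
    chartHamiltonian φ y q = √(q ((chartMetric φ y).inverse q)) := by
  obtain ⟨w, hw, hq⟩ := exists_chartMetric_eq hφ hy q
  obtain ⟨e, he⟩ := chartMetric_isInvertible hφ hy
  rw [hq, ← he, ContinuousLinearMap.inverse_equiv]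
  rw [← he] at hw
  change _ = √(q (e.symm q))
  rw [← hw]
  simp

lemma chartHamiltonian_pos {φ : OpenPartialHomeomorph M Plane}
    (hφ : φ ∈ IsManifold.maximalAtlas (𝓡 2) ω M) {y : Plane} (hy : y ∈ φ.target)
    {q : Plane →L[ℝ] ℝ} (hq : q ≠ 0) : 0 < chartHamiltonian φ y q := by
  refine norm_pos_iff.2 fun h ↦ hq ?_
  let e := chartDifferentialEquiv hφ (φ.map_target hy)
  ext v
  have h' : ∀ u, q (e u) = 0 := fun u ↦ congrArg
    (fun f : TangentSpace (𝓡 2) (φ.symm y) →L[ℝ] ℝ ↦ f u) h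
  simpa using h' (e.symm v)

lemma chartHamiltonian_neg (φ : OpenPartialHomeomorph M Plane) (y : Plane) (q : Plane →L[ℝ] ℝ) :
    chartHamiltonian φ y (-q) = chartHamiltonian φ y q := by
  rw [chartHamiltonian, chartHamiltonian, ContinuousLinearMap.neg_comp]
  exact norm_neg (CotangentSpace.ofForm (q.comp (chartDifferential φ (φ.symm y))))

variable [IsContMDiffRiemannianBundle (𝓡 2) ω Plane (fun x : M ↦ TangentSpace (𝓡 2) x)]

/-- The coordinate fields `dφ⁻¹ v` are analytic sections of the tangent bundle, and the metric pairs
analytic sections to analytic functions. -/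
lemma contDiffOn_chartMetric {φ : OpenPartialHomeomorph M Plane}
    (hφ : φ ∈ IsManifold.maximalAtlas (𝓡 2) ω M) : ContDiffOn ℝ ω (chartMetric φ) φ.target := by
  have hsec : ∀ v : Plane, ContMDiffOn (𝓡 2) (𝓡 2).tangent ω
      (fun y ↦ (⟨φ.symm y, mfderiv (𝓡 2) (𝓡 2) φ.symm y v⟩ : TangentBundle (𝓡 2) M))
      φ.target := by
    intro v
    have h1 := (contMDiffOn_symm_of_mem_maximalAtlas hφ).contMDiffOn_tangentMapWithin
      (m := ω) (by simp) φ.open_target.uniqueMDiffOn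
    have h2 : ContMDiff (𝓡 2) (𝓡 2).tangent ω
        (fun y : Plane ↦ (⟨y, v⟩ : TangentBundle (𝓡 2) Plane)) :=
      contMDiff_vectorSpace_iff_contDiff.2 contDiff_const
    refine (h1.comp h2.contMDiffOn (s := φ.target) fun y hy ↦ hy).congr fun y hy ↦ ?_
    simp only [Function.comp_apply, tangentMapWithin]
    rw [mfderivWithin_of_isOpen φ.open_target hy]
  refine contDiffOn_clm_apply.2 fun v ↦ contDiffOn_clm_apply.2 fun w ↦ ?_
  refine contMDiffOn_iff_contDiffOn.1 (((hsec v).inner_bundle (hsec w)).congr fun y hy ↦ ?_)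
  rw [chartMetric_apply, inverse_chartDifferential_symm hφ hy]
  rfl

/-- The coordinates of `T*M`. -/
local notation "𝔼" => Plane × (Plane →L[ℝ] ℝ)

lemma contDiffAt_chartHamiltonian {φ : OpenPartialHomeomorph M Plane}
    (hφ : φ ∈ IsManifold.maximalAtlas (𝓡 2) ω M) {w : 𝔼} (hy : w.1 ∈ φ.target) (hq : w.2 ≠ 0) :
    ContDiffAt ℝ ω (fun w : 𝔼 ↦ chartHamiltonian φ w.1 w.2) w := by
  have hpos := chartHamiltonian_pos hφ hy hq
  rw [chartHamiltonian_eq_sqrt hφ hy] at hpos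
  have hG : ContDiffAt ℝ ω (fun w : 𝔼 ↦ chartMetric φ w.1) w :=
    ContDiffAt.comp (g := chartMetric φ) w
      ((contDiffOn_chartMetric hφ).contDiffAt (φ.open_target.mem_nhds hy)) contDiffAt_fst
  have hG' : ContDiffAt ℝ ω (fun w : 𝔼 ↦ (chartMetric φ w.1).inverse) w :=
    ContDiffAt.comp (g := ContinuousLinearMap.inverse) w
      (chartMetric_isInvertible hφ hy).contDiffAt_map_inverse hG
  have hS := (contDiffAt_snd.clm_apply (hG'.clm_apply contDiffAt_snd)).sqrt
    (Real.sqrt_pos.1 hpos).ne'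
  refine hS.congr_of_eventuallyEq ?_
  filter_upwards [continuousAt_fst.eventually (φ.open_target.mem_nhds hy)] with w hw
  exact chartHamiltonian_eq_sqrt hφ hw _

/-- The point of the plane at which a functional on covectors is the evaluation. -/
def evaluationPoint (m : (Plane →L[ℝ] ℝ) →L[ℝ] ℝ) : Plane :=
  ∑ i, m (EuclideanSpace.proj i) • EuclideanSpace.single i (1 : ℝ)

/-- Reflexivity of the plane, which turns `∂H/∂q` into a velocity vector. -/
lemma apply_evaluationPoint (m : (Plane →L[ℝ] ℝ) →L[ℝ] ℝ) (r : Plane →L[ℝ] ℝ) :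
    r (evaluationPoint m) = m r := by
  have hr : r = ∑ i, r (EuclideanSpace.single i (1 : ℝ)) •
      (EuclideanSpace.proj i : Plane →L[ℝ] ℝ) := by
    ext v
    conv_lhs => rw [← (EuclideanSpace.basisFun (Fin 2) ℝ).sum_repr v]
    simp [mul_comm]
  conv_rhs => rw [hr]
  simp [evaluationPoint, mul_comm]

/-- The Hamiltonian vector field in the coordinates induced by a chart. -/
def hamiltonField (φ : OpenPartialHomeomorph M Plane) (w : 𝔼) : 𝔼 :=
  (evaluationPoint ((fderiv ℝ (fun w : 𝔼 ↦ chartHamiltonian φ w.1 w.2) w).comp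
      (ContinuousLinearMap.inr ℝ Plane (Plane →L[ℝ] ℝ))),
    -(fderiv ℝ (fun w : 𝔼 ↦ chartHamiltonian φ w.1 w.2) w).comp
      (ContinuousLinearMap.inl ℝ Plane (Plane →L[ℝ] ℝ)))

lemma contDiffAt_hamiltonField {φ : OpenPartialHomeomorph M Plane}
    (hφ : φ ∈ IsManifold.maximalAtlas (𝓡 2) ω M) {w : 𝔼} (hy : w.1 ∈ φ.target) (hq : w.2 ≠ 0) :
    ContDiffAt ℝ ω (hamiltonField φ) w := by
  have hD : ContDiffAt ℝ ω (fderiv ℝ (fun w : 𝔼 ↦ chartHamiltonian φ w.1 w.2)) w :=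
    (contDiffAt_chartHamiltonian hφ hy hq).fderiv_right (by simp)
  have h2 : ContDiffAt ℝ ω (fun w : 𝔼 ↦
      (fderiv ℝ (fun w : 𝔼 ↦ chartHamiltonian φ w.1 w.2) w).comp
        (ContinuousLinearMap.inl ℝ Plane (Plane →L[ℝ] ℝ))) w :=
    hD.clm_comp (contDiffAt_const (c := ContinuousLinearMap.inl ℝ Plane (Plane →L[ℝ] ℝ)))
  exact (ContDiffAt.sum fun i _ ↦ (hD.clm_apply contDiffAt_const).smul contDiffAt_const).prodMk
    h2.neg

end ChartHamiltonian
end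

/-! ### Coordinates of `T*M`, and uniqueness of orbits. -/

noncomputable section

open Set Filter Topology

section ChartCoordinates

variable {M : Type*} [TopologicalSpace M] [ChartedSpace Plane M] [IsManifold (𝓡 2) ω M]

/-- The coordinates of `T*M`. -/
local notation "𝔼" => Plane × (Plane →L[ℝ] ℝ)

/-- The coordinates of a point of `T*M` that are induced by a chart. -/
def chartCoord (φ : OpenPartialHomeomorph M Plane) (z : CotangentPoint M) : 𝔼 :=
  (φ z.proj, chartMomentum φ z)

lemma chartMomentum_eq {φ : OpenPartialHomeomorph M Plane}
    (hφ : φ ∈ IsManifold.maximalAtlas (𝓡 2) ω M) {x : M} (hx : x ∈ φ.source)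
    (ξ : CotangentSpace x) :
    chartMomentum φ (⟨x, ξ⟩ : CotangentPoint M) =
      ξ.toForm.comp ((chartDifferentialEquiv hφ hx).symm : Plane →L[ℝ] TangentSpace (𝓡 2) x) := by
  rw [chartMomentum, inverse_chartDifferential hφ hx]

lemma chartCoord_injOn {φ : OpenPartialHomeomorph M Plane}
    (hφ : φ ∈ IsManifold.maximalAtlas (𝓡 2) ω M) {z z' : CotangentPoint M}
    (hz : z.proj ∈ φ.source) (hz' : z'.proj ∈ φ.source) (h : chartCoord φ z = chartCoord φ z') :
    z = z' := by
  obtain ⟨x, ξ⟩ := z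
  obtain ⟨x', ξ'⟩ := z'
  obtain rfl : x = x' := φ.injOn hz hz' (congrArg Prod.fst h)
  have h2 : chartMomentum φ (⟨x, ξ⟩ : CotangentPoint M) = chartMomentum φ ⟨x, ξ'⟩ :=
    congrArg Prod.snd h
  rw [chartMomentum_eq hφ hz, chartMomentum_eq hφ hz] at h2
  have h3 : ξ.toForm = ξ'.toForm := by
    ext v
    have h4 := congrArg (fun f : Plane →L[ℝ] ℝ ↦ f (chartDifferentialEquiv hφ hz v)) h2
    change ξ.toForm ((chartDifferentialEquiv hφ hz).symm (chartDifferentialEquiv hφ hz v)) =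
      ξ'.toForm ((chartDifferentialEquiv hφ hz).symm (chartDifferentialEquiv hφ hz v)) at h4
    rwa [(chartDifferentialEquiv hφ hz).symm_apply_apply] at h4
  have h5 : ξ = ξ' := h3
  rw [h5]

/-- The change of coordinates of `T*M` between two charts. -/
def coordChange (φ ψ : OpenPartialHomeomorph M Plane) (w : 𝔼) : 𝔼 :=
  (ψ (φ.symm w.1), w.2.comp (fderiv ℝ (φ ∘ ψ.symm) (ψ (φ.symm w.1))))

lemma contDiffAt_chart_comp_symm {φ ψ : OpenPartialHomeomorph M Plane}
    (hφ : φ ∈ IsManifold.maximalAtlas (𝓡 2) ω M) (hψ : ψ ∈ IsManifold.maximalAtlas (𝓡 2) ω M)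
    {y : Plane} (hy : y ∈ ψ.target) (hy' : ψ.symm y ∈ φ.source) :
    ContDiffAt ℝ ω (φ ∘ ψ.symm) y := by
  have h1 : ContMDiffAt (𝓡 2) (𝓡 2) ω φ (ψ.symm y) :=
    (contMDiffOn_of_mem_maximalAtlas hφ).contMDiffAt (φ.open_source.mem_nhds hy')
  have h2 : ContMDiffAt (𝓡 2) (𝓡 2) ω ψ.symm y :=
    (contMDiffOn_symm_of_mem_maximalAtlas hψ).contMDiffAt (ψ.open_target.mem_nhds hy)
  exact contMDiffAt_iff_contDiffAt.1 (h1.comp y h2)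

lemma contDiffAt_coordChange {φ ψ : OpenPartialHomeomorph M Plane}
    (hφ : φ ∈ IsManifold.maximalAtlas (𝓡 2) ω M) (hψ : ψ ∈ IsManifold.maximalAtlas (𝓡 2) ω M)
    {w : 𝔼} (hw : w.1 ∈ φ.target) (hw' : φ.symm w.1 ∈ ψ.source) :
    ContDiffAt ℝ ω (coordChange φ ψ) w := by
  have h1 : ContDiffAt ℝ ω (fun w : 𝔼 ↦ ψ (φ.symm w.1)) w :=
    ContDiffAt.comp (g := ψ ∘ φ.symm) w (contDiffAt_chart_comp_symm hψ hφ hw hw') contDiffAt_fst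
  have h2 : ContDiffAt ℝ ω (fderiv ℝ (φ ∘ ψ.symm)) (ψ (φ.symm w.1)) :=
    (contDiffAt_chart_comp_symm hφ hψ (ψ.map_source hw')
      (by rw [ψ.left_inv hw']; exact φ.map_target hw)).fderiv_right (by simp)
  exact h1.prodMk (contDiffAt_snd.clm_comp (ContDiffAt.comp (f := fun w : 𝔼 ↦ ψ (φ.symm w.1)) w h2 h1))

lemma chartCoord_eq_coordChange {φ ψ : OpenPartialHomeomorph M Plane}
    (hφ : φ ∈ IsManifold.maximalAtlas (𝓡 2) ω M) (hψ : ψ ∈ IsManifold.maximalAtlas (𝓡 2) ω M)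
    {z : CotangentPoint M} (hz : z.proj ∈ φ.source) (hz' : z.proj ∈ ψ.source) :
    chartCoord ψ z = coordChange φ ψ (chartCoord φ z) := by
  obtain ⟨x, ξ⟩ := z
  change x ∈ φ.source at hz
  change x ∈ ψ.source at hz'
  refine Prod.ext ?_ ?_
  · change ψ x = ψ (φ.symm (φ x))
    rw [φ.left_inv hz]
  · change chartMomentum ψ (⟨x, ξ⟩ : CotangentPoint M) =
      (chartMomentum φ (⟨x, ξ⟩ : CotangentPoint M)).comp
        (fderiv ℝ (φ ∘ ψ.symm) (ψ (φ.symm (φ x))))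
    -- The chain rule needs the differential at `ψ.symm (ψ x)`, which equals `x` only
    -- propositionally; hence the variable base point.
    have h1 : ∀ x', x' = x → HasMFDerivAt (𝓡 2) (𝓡 2) φ x'
        (show TangentSpace (𝓡 2) x' →L[ℝ] TangentSpace (𝓡 2) (φ x') from
          (chartDifferentialEquiv hφ hz : TangentSpace (𝓡 2) x →L[ℝ] Plane)) := by
      rintro _ rfl
      exact ((mdifferentiable_of_mem_maximalAtlas hφ).mdifferentiableAt hz).hasMFDerivAt
    have h2 : HasMFDerivAt (𝓡 2) (𝓡 2) ψ.symm (ψ x) (mfderiv (𝓡 2) (𝓡 2) ψ.symm (ψ x)) :=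
      ((mdifferentiable_of_mem_maximalAtlas hψ).mdifferentiableAt_symm
        (ψ.map_source hz')).hasMFDerivAt
    have h3 : HasFDerivAt (φ ∘ ψ.symm)
        ((chartDifferentialEquiv hφ hz : TangentSpace (𝓡 2) x →L[ℝ] Plane).comp
          ((chartDifferentialEquiv hψ hz').symm : Plane →L[ℝ] TangentSpace (𝓡 2) x)) (ψ x) :=
      hasMFDerivAt_iff_hasFDerivAt.1 ((h1 _ (ψ.left_inv hz')).comp (ψ x) h2)
    rw [φ.left_inv hz, chartMomentum_eq hφ hz, chartMomentum_eq hψ hz', h3.fderiv]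
    ext v
    change ξ.toForm ((chartDifferentialEquiv hψ hz').symm v) =
      ξ.toForm ((chartDifferentialEquiv hφ hz).symm (chartDifferentialEquiv hφ hz
        ((chartDifferentialEquiv hψ hz').symm v)))
    rw [(chartDifferentialEquiv hφ hz).symm_apply_apply]

variable [RiemannianBundle (fun x : M ↦ TangentSpace (𝓡 2) x)]

/-- Unit covectors avoid the zero section, where the smoothness of `H` fails. -/
lemma chartMomentum_ne_zero {φ : OpenPartialHomeomorph M Plane}
    (hφ : φ ∈ IsManifold.maximalAtlas (𝓡 2) ω M) {z : CotangentPoint M}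
    (hz : z.proj ∈ φ.source) (h1 : ‖z.snd‖ = 1) : chartMomentum φ z ≠ 0 := by
  obtain ⟨x, ξ⟩ := z
  change x ∈ φ.source at hz
  rw [chartMomentum_eq hφ hz]
  intro h
  have h3 : ξ.toForm = 0 := by
    ext v
    have h4 := congrArg (fun f : Plane →L[ℝ] ℝ ↦ f (chartDifferentialEquiv hφ hz v)) h
    change ξ.toForm ((chartDifferentialEquiv hφ hz).symm (chartDifferentialEquiv hφ hz v)) = 0 at h4
    rwa [(chartDifferentialEquiv hφ hz).symm_apply_apply] at h4
  have h5 : ξ = 0 := h3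
  rw [h5] at h1
  simp at h1

end ChartCoordinates

section Orbits

variable {M : Type*} [TopologicalSpace M] [ChartedSpace Plane M] [IsManifold (𝓡 2) ω M]
  [RiemannianBundle (fun x : M ↦ TangentSpace (𝓡 2) x)]

local notation "𝔼" => Plane × (Plane →L[ℝ] ℝ)

/-- The momentum coordinates of opposite covectors are opposite. -/
lemma chartMomentum_neg (φ : OpenPartialHomeomorph M Plane) (z : CotangentPoint M) :
    chartMomentum φ ⟨z.proj, -z.snd⟩ = -chartMomentum φ z := rfl

lemma IsUnitHamiltonOrbit.comp_add {γ : ℝ → CotangentPoint M} (hγ : IsUnitHamiltonOrbit γ)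
    (s : ℝ) : IsUnitHamiltonOrbit fun t ↦ γ (t + s) where
  continuous_proj := hγ.continuous_proj.comp (continuous_add_const s)
  norm_eq_one t := hγ.norm_eq_one (t + s)
  hamilton φ hφ t ht := by
    obtain ⟨⟨v, hv, hr⟩, h2⟩ := hγ.hamilton φ hφ (t + s) ht
    exact ⟨⟨v, hv.comp_add_const t s, hr⟩, h2.comp_add_const t s⟩

/-- Time reversal. -/
lemma IsUnitHamiltonOrbit.reverse {γ : ℝ → CotangentPoint M} (hγ : IsUnitHamiltonOrbit γ) :
    IsUnitHamiltonOrbit fun t ↦ (⟨(γ (-t)).proj, -(γ (-t)).snd⟩ : CotangentPoint M) where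
  continuous_proj := hγ.continuous_proj.comp continuous_neg
  norm_eq_one t := (norm_neg _).trans (hγ.norm_eq_one (-t))
  hamilton φ hφ t ht := by
    obtain ⟨⟨v, hv, hr⟩, h2⟩ := hγ.hamilton φ hφ (-t) ht
    refine ⟨⟨-v, ?_, fun r ↦ ?_⟩, ?_⟩
    · exact (hv.scomp t (hasDerivAt_neg t)).congr_deriv (by rw [neg_smul, one_smul])
    · rw [map_neg, hr, chartMomentum_neg]
      -- `H` is even in `q`, so `∂H/∂q` is odd, which matches the reversed velocity.
      have h : (fun q ↦ chartHamiltonian φ (φ (γ (-t)).proj) q) =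
          fun q ↦ chartHamiltonian φ (φ (γ (-t)).proj) ((-1 : ℝ) • q) := by
        ext q
        rw [neg_one_smul ℝ q, chartHamiltonian_neg]
      conv_lhs => rw [h]
      rw [fderiv_comp_smul (f := fun q ↦ chartHamiltonian φ (φ (γ (-t)).proj) q) (-1 : ℝ)]
      simp
    · simp only [chartMomentum_neg, chartHamiltonian_neg]
      exact (h2.scomp t (hasDerivAt_neg t)).neg.congr_deriv (by rw [neg_smul, one_smul, neg_neg])

variable [IsContMDiffRiemannianBundle (𝓡 2) ω Plane (fun x : M ↦ TangentSpace (𝓡 2) x)]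

/-- The partial derivatives of `H` are restrictions of its total derivative, so Hamilton's two
equations combine into one autonomous equation with an analytic field. -/
lemma IsUnitHamiltonOrbit.hasDerivAt {γ : ℝ → CotangentPoint M} (hγ : IsUnitHamiltonOrbit γ)
    {φ : OpenPartialHomeomorph M Plane} (hφ : φ ∈ IsManifold.maximalAtlas (𝓡 2) ω M) {t : ℝ}
    (ht : (γ t).proj ∈ φ.source) :
    HasDerivAt (fun s ↦ chartCoord φ (γ s)) (hamiltonField φ (chartCoord φ (γ t))) t := by
  obtain ⟨⟨v, hv, hr⟩, h2⟩ := hγ.hamilton φ hφ t ht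
  have hD := ((contDiffAt_chartHamiltonian hφ (w := chartCoord φ (γ t)) (φ.map_source ht)
    (chartMomentum_ne_zero hφ ht (hγ.norm_eq_one t))).differentiableAt (by simp)).hasFDerivAt
  have hq := HasFDerivAt.comp (chartMomentum φ (γ t)) hD
    (hasFDerivAt_prodMk_right (𝕜 := ℝ) (φ (γ t).proj) (chartMomentum φ (γ t)))
  have hy := HasFDerivAt.comp (φ (γ t).proj) hD
    (hasFDerivAt_prodMk_left (𝕜 := ℝ) (φ (γ t).proj) (chartMomentum φ (γ t)))
  have hv' : v = (hamiltonField φ (chartCoord φ (γ t))).1 := by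
    have key : ∀ r : Plane →L[ℝ] ℝ, r v = r (hamiltonField φ (chartCoord φ (γ t))).1 := by
      intro r
      rw [hr, hamiltonField, apply_evaluationPoint]
      exact congrArg (fun f : (Plane →L[ℝ] ℝ) →L[ℝ] ℝ ↦ f r) hq.fderiv
    ext i
    exact key (EuclideanSpace.proj i)
  refine (hv' ▸ hv).prodMk ?_
  have h3 : (hamiltonField φ (chartCoord φ (γ t))).2 =
      -fderiv ℝ (fun y ↦ chartHamiltonian φ y (chartMomentum φ (γ t))) (φ (γ t).proj) :=
    congrArg Neg.neg hy.fderiv.symm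
  exact h2.congr_deriv h3.symm

/-- An orbit coincides with any solution of Hamilton's equations in a chart, as long as the latter
exists, if they coincide once. -/
theorem IsUnitHamiltonOrbit.chartCoord_eq_of_solution [T2Space M] {γ : ℝ → CotangentPoint M}
    (hγ : IsUnitHamiltonOrbit γ) {φ : OpenPartialHomeomorph M Plane}
    (hφ : φ ∈ IsManifold.maximalAtlas (𝓡 2) ω M) {a b t₀ : ℝ} (ht₀ : t₀ ∈ Ioo a b) {c : ℝ → 𝔼}
    (hc : ∀ t ∈ Ioo a b, HasDerivAt c (hamiltonField φ (c t)) t ∧ (c t).1 ∈ φ.target ∧ (c t).2 ≠ 0)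
    (h₀ : (γ t₀).proj ∈ φ.source) (h₁ : chartCoord φ (γ t₀) = c t₀) :
    ∀ t ∈ Ioo a b, (γ t).proj ∈ φ.source ∧ chartCoord φ (γ t) = c t := by
  have hopen : ∀ t ∈ Ioo a b, (γ t).proj ∈ φ.source → chartCoord φ (γ t) = c t →
      ∀ᶠ s in 𝓝 t, (γ s).proj ∈ φ.source ∧ chartCoord φ (γ s) = c s := by
    intro t ht hs he
    obtain ⟨hct, hct1, hct2⟩ := hc t ht
    have hsrc : ∀ᶠ s in 𝓝 t, (γ s).proj ∈ φ.source :=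
      hγ.continuous_proj.continuousAt.eventually (φ.open_source.mem_nhds hs)
    obtain ⟨K, S, hS, hK⟩ := ((contDiffAt_hamiltonField hφ hct1 hct2).of_le
      (show (1 : WithTop ℕ∞) ≤ ω from le_top)).exists_lipschitzOnWith
    have hcS : ∀ᶠ s in 𝓝 t, c s ∈ S := hct.continuousAt.eventually hS
    have hγS : ∀ᶠ s in 𝓝 t, chartCoord φ (γ s) ∈ S :=
      (hγ.hasDerivAt hφ hs).continuousAt.eventually
        (show S ∈ 𝓝 (chartCoord φ (γ t)) from he ▸ hS)
    have huniq : (fun s ↦ chartCoord φ (γ s)) =ᶠ[𝓝 t] c := by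
      refine ODE_solution_unique_of_eventually (v := fun _ ↦ hamiltonField φ) (s := fun _ ↦ S)
        (K := K) (Eventually.of_forall fun _ ↦ hK) ?_ ?_ he
      · filter_upwards [hsrc, hγS] with s h1 h2
        exact ⟨hγ.hasDerivAt hφ h1, h2⟩
      · filter_upwards [Ioo_mem_nhds ht.1 ht.2, hcS] with s h1 h2
        exact ⟨(hc s h1).1, h2⟩
    exact hsrc.and huniq
  let u : Set ℝ := {t | t ∈ Ioo a b ∧ (γ t).proj ∈ φ.source ∧ chartCoord φ (γ t) = c t}
  have hu : IsOpen u := isOpen_iff_mem_nhds.2 fun t ht ↦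
    inter_mem (Ioo_mem_nhds ht.1.1 ht.1.2) (hopen t ht.1 ht.2.1 ht.2.2)
  have hclosed : closure u ∩ Ioo a b ⊆ u := by
    rintro t ⟨htu, ht⟩
    obtain ⟨hct, hct1, hct2⟩ := hc t ht
    have hfreq : ∃ᶠ s in 𝓝 t, s ∈ u := mem_closure_iff_frequently.1 htu
    have hlim1 : Tendsto (fun s ↦ φ.symm (c s).1) (𝓝 t) (𝓝 (φ.symm (c t).1)) :=
      (φ.continuousAt_symm hct1).tendsto.comp (continuous_fst.continuousAt.comp hct.continuousAt)
    have hlim2 : Tendsto (fun s ↦ (γ s).proj) (𝓝 t) (𝓝 (γ t).proj) :=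
      hγ.continuous_proj.continuousAt
    -- Since `M` is Hausdorff, the limit of the projections is the one predicted by `c`; so the
    -- orbit cannot leave the chart while `c` stays in it.
    have hproj : (γ t).proj = φ.symm (c t).1 := by
      refine tendsto_nhds_unique_of_frequently_eq hlim2 hlim1 (hfreq.mono fun s hs ↦ ?_)
      rw [← hs.2.2]
      exact (φ.left_inv hs.2.1).symm
    have hsrc : (γ t).proj ∈ φ.source := hproj ▸ φ.map_target hct1
    exact ⟨ht, hsrc, tendsto_nhds_unique_of_frequently_eq
      (hγ.hasDerivAt hφ hsrc).continuousAt hct.continuousAt (hfreq.mono fun s hs ↦ hs.2.2)⟩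
  intro t ht
  exact (isPreconnected_Ioo.subset_of_closure_inter_subset hu ⟨t₀, ht₀, ht₀, h₀, h₁⟩ hclosed ht).2

/-- Orbits that meet are equal. -/
theorem IsUnitHamiltonOrbit.eq_of_eq_at [T2Space M] {γ γ' : ℝ → CotangentPoint M}
    (hγ : IsUnitHamiltonOrbit γ) (hγ' : IsUnitHamiltonOrbit γ') {t₀ : ℝ} (h : γ t₀ = γ' t₀) :
    γ = γ' := by
  let u : Set ℝ := {t | γ t = γ' t}
  have hu : IsOpen u := by
    refine isOpen_iff_mem_nhds.2 fun t (ht : γ t = γ' t) ↦ ?_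
    let φ := chartAt Plane (γ' t).proj
    have hφ : φ ∈ IsManifold.maximalAtlas (𝓡 2) ω M := IsManifold.chart_mem_maximalAtlas _
    have hs : (γ' t).proj ∈ φ.source := mem_chart_source _ _
    have hsrc : ∀ᶠ s in 𝓝 t, (γ' s).proj ∈ φ.source :=
      hγ'.continuous_proj.continuousAt.eventually (φ.open_source.mem_nhds hs)
    obtain ⟨ε, hε, hball⟩ := Metric.eventually_nhds_iff_ball.1 hsrc
    rw [Real.ball_eq_Ioo] at hball
    have htI : t ∈ Ioo (t - ε) (t + ε) := ⟨by linarith, by linarith⟩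
    have key := hγ.chartCoord_eq_of_solution hφ htI (c := fun s ↦ chartCoord φ (γ' s))
      (fun s hs ↦ ⟨hγ'.hasDerivAt hφ (hball s hs), φ.map_source (hball s hs),
        chartMomentum_ne_zero hφ (hball s hs) (hγ'.norm_eq_one s)⟩) (ht ▸ hs) (by rw [ht])
    filter_upwards [Ioo_mem_nhds htI.1 htI.2] with s hs
    exact chartCoord_injOn hφ (key s hs).1 (hball s hs) (key s hs).2
  have hcl : IsClosed u := by
    refine isClosed_of_closure_subset fun t ht ↦ ?_
    have hfreq : ∃ᶠ s in 𝓝 t, γ s = γ' s := mem_closure_iff_frequently.1 ht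
    -- Only projections are continuous by definition. Once these agree, both orbits lie in a common
    -- chart at `t`, where the momenta are continuous because they are differentiable.
    have hproj : (γ t).proj = (γ' t).proj :=
      tendsto_nhds_unique_of_frequently_eq hγ.continuous_proj.continuousAt
        hγ'.continuous_proj.continuousAt (hfreq.mono fun s hs ↦ congrArg _ hs)
    let φ := chartAt Plane (γ' t).proj
    have hφ : φ ∈ IsManifold.maximalAtlas (𝓡 2) ω M := IsManifold.chart_mem_maximalAtlas _
    have hs' : (γ' t).proj ∈ φ.source := mem_chart_source _ _
    have hs : (γ t).proj ∈ φ.source := hproj ▸ hs'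
    exact chartCoord_injOn hφ hs hs' (tendsto_nhds_unique_of_frequently_eq
      (hγ.hasDerivAt hφ hs).continuousAt (hγ'.hasDerivAt hφ hs').continuousAt
      (hfreq.mono fun s hs ↦ congrArg (chartCoord φ) hs))
  have huniv : u = univ := IsClopen.eq_univ ⟨hcl, hu⟩ ⟨t₀, h⟩
  ext1 t
  exact (huniv ▸ mem_univ t : t ∈ u)

end Orbits
end

/-! ### Analytic curves in `T*M` and their transport by the flow. -/

noncomputable section

open Set Filter Topology

/-- The solutions of a smooth autonomous ordinary differential equation are smooth. -/
lemma contDiffAt_of_eventually_hasDerivAt {E : Type*} [NormedAddCommGroup E] [NormedSpace ℝ E]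
    {X : E → E} {c : ℝ → E} {t : ℝ} (hX : ContDiffAt ℝ ∞ X (c t))
    (hc : ∀ᶠ s in 𝓝 t, HasDerivAt c (X (c s)) s) : ContDiffAt ℝ ∞ c t := by
  refine contDiffAt_infty.2 fun n ↦ ?_
  induction n with
  | zero => exact contDiffAt_zero.2 ⟨_, hc, fun s hs ↦ (HasDerivAt.continuousAt hs).continuousWithinAt⟩
  | succ n ih =>
    refine contDiffAt_succ_iff_hasFDerivAt.2
      ⟨fun s ↦ (1 : ℝ →L[ℝ] ℝ).smulRight (X (c s)), ⟨_, hc, fun s hs ↦ ?_⟩, ?_⟩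
    · exact (HasDerivAt.hasFDerivAt hs).congr_fderiv (by ext; simp)
    · exact contDiffAt_const.smulRight
        (ContDiffAt.comp t (hX.of_le (by exact_mod_cast le_top)) ih)

section AnalyticCurves

variable {M : Type*} [TopologicalSpace M] [ChartedSpace Plane M] [IsManifold (𝓡 2) ω M]

local notation "𝔼" => Plane × (Plane →L[ℝ] ℝ)

/-- A curve in `T*M`, not necessarily an orbit, is real analytic at `θ₀`. -/
structure IsAnalyticCurveAt (c : ℝ → CotangentPoint M) (θ₀ : ℝ) : Prop where
  continuousAt_proj : ContinuousAt (fun θ ↦ (c θ).proj) θ₀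
  contDiffAt_chartCoord : ∀ φ ∈ IsManifold.maximalAtlas (𝓡 2) ω M, (c θ₀).proj ∈ φ.source →
    ContDiffAt ℝ ω (fun θ ↦ chartCoord φ (c θ)) θ₀

lemma IsAnalyticCurveAt.eventually_mem {c : ℝ → CotangentPoint M} {θ₀ : ℝ}
    (hc : IsAnalyticCurveAt c θ₀) {φ : OpenPartialHomeomorph M Plane}
    (h : (c θ₀).proj ∈ φ.source) : ∀ᶠ θ in 𝓝 θ₀, (c θ).proj ∈ φ.source :=
  hc.continuousAt_proj.eventually (φ.open_source.mem_nhds h)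

/-- Analyticity can be tested in one chart. -/
lemma IsAnalyticCurveAt.of_chart {c : ℝ → CotangentPoint M} {θ₀ : ℝ}
    {φ : OpenPartialHomeomorph M Plane} (hφ : φ ∈ IsManifold.maximalAtlas (𝓡 2) ω M)
    (hs : ∀ᶠ θ in 𝓝 θ₀, (c θ).proj ∈ φ.source)
    (hc : ContDiffAt ℝ ω (fun θ ↦ chartCoord φ (c θ)) θ₀) : IsAnalyticCurveAt c θ₀ := by
  have h0 : (c θ₀).proj ∈ φ.source := hs.self_of_nhds
  have hcont : ContinuousAt (fun θ ↦ (c θ).proj) θ₀ := by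
    have h1 : ContinuousAt (fun θ ↦ φ.symm (chartCoord φ (c θ)).1) θ₀ :=
      ContinuousAt.comp (g := φ.symm) (φ.continuousAt_symm (φ.map_source h0))
        (continuous_fst.continuousAt.comp hc.continuousAt)
    refine h1.congr ?_
    filter_upwards [hs] with θ hθ
    exact φ.left_inv hθ
  refine ⟨hcont, fun ψ hψ h0' ↦ ?_⟩
  have h2 : ContDiffAt ℝ ω (coordChange φ ψ) (chartCoord φ (c θ₀)) :=
    contDiffAt_coordChange hφ hψ (φ.map_source h0) (by
      change φ.symm (φ (c θ₀).proj) ∈ _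
      rwa [φ.left_inv h0])
  refine (ContDiffAt.comp (g := coordChange φ ψ) θ₀ h2 hc).congr_of_eventuallyEq ?_
  filter_upwards [hs, hcont.eventually (ψ.open_source.mem_nhds h0')] with θ h3 h4
  exact chartCoord_eq_coordChange hφ hψ h3 h4

/-- A curve in one fibre `T*ₚM` is analytic if it is analytic as a curve in a vector space. -/
lemma IsAnalyticCurveAt.of_fiber {p : M} {ξ : ℝ → TangentSpace (𝓡 2) p →L[ℝ] ℝ}
    (hξ : ∀ v, ContDiff ℝ ω (fun θ ↦ ξ θ v)) (θ₀ : ℝ) :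
    IsAnalyticCurveAt (fun θ ↦ (⟨p, CotangentSpace.ofForm (ξ θ)⟩ : CotangentPoint M)) θ₀ := by
  have hφ : chartAt Plane p ∈ IsManifold.maximalAtlas (𝓡 2) ω M :=
    IsManifold.chart_mem_maximalAtlas _
  have hp : p ∈ (chartAt Plane p).source := mem_chart_source _ _
  have hm : ContDiff ℝ ω (fun θ ↦ chartMomentum (chartAt Plane p)
      (⟨p, CotangentSpace.ofForm (ξ θ)⟩ : CotangentPoint M)) := by
    refine contDiff_clm_apply_iff.2 fun v ↦ ?_
    simp only [chartMomentum_eq hφ hp]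
    exact hξ _
  have hc : ContDiffAt ℝ ω (fun _ : ℝ ↦ chartAt Plane p p) θ₀ := contDiffAt_const
  exact .of_chart hφ (Eventually.of_forall fun _ ↦ hp) (hc.prodMk hm.contDiffAt)

lemma IsAnalyticCurveAt.contDiffAt_fiber {p : M} {ξ : ℝ → TangentSpace (𝓡 2) p →L[ℝ] ℝ} {θ₀ : ℝ}
    (h : IsAnalyticCurveAt (fun θ ↦ (⟨p, CotangentSpace.ofForm (ξ θ)⟩ : CotangentPoint M)) θ₀)
    (v : TangentSpace (𝓡 2) p) : ContDiffAt ℝ ω (fun θ ↦ ξ θ v) θ₀ := by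
  have hφ : chartAt Plane p ∈ IsManifold.maximalAtlas (𝓡 2) ω M :=
    IsManifold.chart_mem_maximalAtlas _
  have hp : p ∈ (chartAt Plane p).source := mem_chart_source _ _
  have h1 := (contDiffAt_snd.comp θ₀ (h.contDiffAt_chartCoord _ hφ hp)).clm_apply
    (contDiffAt_const (c := chartDifferentialEquiv hφ hp v))
  refine h1.congr_of_eventuallyEq (Eventually.of_forall fun θ ↦ ?_)
  change ξ θ v = chartMomentum (chartAt Plane p)
    (⟨p, CotangentSpace.ofForm (ξ θ)⟩ : CotangentPoint M) (chartDifferentialEquiv hφ hp v)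
  rw [chartMomentum_eq hφ hp]
  change ξ θ v = ξ θ ((chartDifferentialEquiv hφ hp).symm (chartDifferentialEquiv hφ hp v))
  rw [(chartDifferentialEquiv hφ hp).symm_apply_apply]

variable [RiemannianBundle (fun x : M ↦ TangentSpace (𝓡 2) x)]
  [IsContMDiffRiemannianBundle (𝓡 2) ω Plane (fun x : M ↦ TangentSpace (𝓡 2) x)]

/-- The Hamilton flow maps analytic curves to analytic curves, for short times. -/
theorem exists_isAnalyticCurveAt_flow [T2Space M] {Γ : ℝ → ℝ → CotangentPoint M}
    (hΓ : ∀ θ, IsUnitHamiltonOrbit (Γ θ)) (θ₀ t₁ : ℝ) :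
    ∃ ε > 0, ∀ s ∈ Ioo (t₁ - ε) (t₁ + ε), ∀ t ∈ Ioo (t₁ - ε) (t₁ + ε),
      IsAnalyticCurveAt (fun θ ↦ Γ θ s) θ₀ → IsAnalyticCurveAt (fun θ ↦ Γ θ t) θ₀ := by
  let φ := chartAt Plane (Γ θ₀ t₁).proj
  have hφ : φ ∈ IsManifold.maximalAtlas (𝓡 2) ω M := IsManifold.chart_mem_maximalAtlas _
  have h₁ : (Γ θ₀ t₁).proj ∈ φ.source := mem_chart_source _ _
  have hne := chartMomentum_ne_zero hφ h₁ ((hΓ θ₀).norm_eq_one t₁)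
  have hX : AnalyticAt ℝ (hamiltonField φ) (chartCoord φ (Γ θ₀ t₁)) :=
    (contDiffAt_hamiltonField hφ (w := chartCoord φ (Γ θ₀ t₁)) (φ.map_source h₁) hne).analyticAt
  have hW : {w : 𝔼 | w.1 ∈ φ.target ∧ w.2 ≠ 0} ∈ 𝓝 (chartCoord φ (Γ θ₀ t₁)) := by
    refine inter_mem (continuousAt_fst.eventually (φ.open_target.mem_nhds (φ.map_source h₁)))
      (continuousAt_snd.eventually_ne hne)
  obtain ⟨ε, hε, U, hU, hzU, Φ, hΦ⟩ := hX.exists_analytic_flow hW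
  have hev : ∀ᶠ s in 𝓝 t₁, (Γ θ₀ s).proj ∈ φ.source ∧ chartCoord φ (Γ θ₀ s) ∈ U :=
    ((hΓ θ₀).continuous_proj.continuousAt.eventually (φ.open_source.mem_nhds h₁)).and
      (((hΓ θ₀).hasDerivAt hφ h₁).continuousAt.eventually (hU.mem_nhds hzU))
  obtain ⟨δ, hδ, hball⟩ := Metric.eventually_nhds_iff_ball.1 hev
  rw [Real.ball_eq_Ioo] at hball
  -- `δ` keeps the orbit of `θ₀` in the chart and in `U`; `ε / 2` makes `|t - s| < ε`, the lifetime
  -- of `Φ`.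
  refine ⟨min δ (ε / 2), by positivity, fun s hs t ht hAn ↦ ?_⟩
  have hδ1 := min_le_left δ (ε / 2)
  have hδ2 := min_le_right δ (ε / 2)
  obtain ⟨hs1, hs2⟩ := hball s ⟨by linarith [hs.1], by linarith [hs.2]⟩
  have hts : t - s ∈ Ioo (-ε) ε :=
    ⟨by linarith [hs.1, hs.2, ht.1, ht.2], by linarith [hs.1, hs.2, ht.1, ht.2]⟩
  have hcs := hAn.contDiffAt_chartCoord φ hφ hs1
  have key : ∀ᶠ θ in 𝓝 θ₀, (Γ θ t).proj ∈ φ.source ∧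
      chartCoord φ (Γ θ t) = Φ (t - s) (chartCoord φ (Γ θ s)) := by
    filter_upwards [hAn.eventually_mem hs1, hcs.continuousAt.eventually (hU.mem_nhds hs2)]
      with θ hθ1 hθ2
    obtain ⟨hΦ0, hΦt⟩ := hΦ _ hθ2
    refine (hΓ θ).chartCoord_eq_of_solution hφ (a := s - ε) (b := s + ε) (t₀ := s)
      ⟨by linarith, by linarith⟩ (c := fun r ↦ Φ (r - s) (chartCoord φ (Γ θ s)))
      (fun r hr ↦ ?_) hθ1 (by simp only [sub_self, hΦ0]) t
      ⟨by linarith [hts.1], by linarith [hts.2]⟩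
    obtain ⟨d1, d2, -⟩ := hΦt (r - s) ⟨by linarith [hr.1], by linarith [hr.2]⟩
    exact ⟨d1.comp_sub_const r s, d2⟩
  refine .of_chart hφ (key.mono fun θ h ↦ h.1) ?_
  have hΦs : ContDiffAt ℝ ω (Φ (t - s)) (chartCoord φ (Γ θ₀ s)) := ((hΦ _ hs2).2 _ hts).2.2
  exact (ContDiffAt.comp (g := Φ (t - s)) θ₀ hΦs hcs).congr_of_eventuallyEq
    (key.mono fun θ h ↦ h.2)

/-- The Hamilton flow maps analytic curves to analytic curves. -/
theorem isAnalyticCurveAt_flow [T2Space M] {Γ : ℝ → ℝ → CotangentPoint M}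
    (hΓ : ∀ θ, IsUnitHamiltonOrbit (Γ θ)) {θ₀ s : ℝ}
    (hs : IsAnalyticCurveAt (fun θ ↦ Γ θ s) θ₀) (t : ℝ) :
    IsAnalyticCurveAt (fun θ ↦ Γ θ t) θ₀ := by
  let u : Set ℝ := {t | IsAnalyticCurveAt (fun θ ↦ Γ θ t) θ₀}
  have hu : IsOpen u := by
    refine isOpen_iff_mem_nhds.2 fun t ht ↦ ?_
    obtain ⟨ε, hε, h⟩ := exists_isAnalyticCurveAt_flow hΓ θ₀ t
    filter_upwards [Ioo_mem_nhds (show t - ε < t by linarith) (show t < t + ε by linarith)]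
      with r hr
    exact h t ⟨by linarith, by linarith⟩ r hr ht
  have hcl : IsClosed u := by
    refine isClosed_of_closure_subset fun t ht ↦ ?_
    obtain ⟨ε, hε, h⟩ := exists_isAnalyticCurveAt_flow hΓ θ₀ t
    -- The interval around `t` works for every pair of times in it, so analyticity at a nearby time
    -- `r` passes to `t`.
    obtain ⟨r, hr, hru⟩ := mem_closure_iff_nhds.1 ht _
      (Ioo_mem_nhds (show t - ε < t by linarith) (show t < t + ε by linarith))
    exact h r hr t ⟨by linarith, by linarith⟩ hru
  have huniv : u = univ := IsClopen.eq_univ ⟨hcl, hu⟩ ⟨s, hs⟩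
  exact (huniv ▸ mem_univ t : t ∈ u)

lemma IsUnitHamiltonOrbit.contMDiff_proj {γ : ℝ → CotangentPoint M} (hγ : IsUnitHamiltonOrbit γ) :
    ContMDiff 𝓘(ℝ, ℝ) (𝓡 2) ∞ (fun t ↦ (γ t).proj) := by
  intro t
  let φ := chartAt Plane (γ t).proj
  have hφ : φ ∈ IsManifold.maximalAtlas (𝓡 2) ω M := IsManifold.chart_mem_maximalAtlas _
  have ht : (γ t).proj ∈ φ.source := mem_chart_source _ _
  have hsrc : ∀ᶠ s in 𝓝 t, (γ s).proj ∈ φ.source :=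
    hγ.continuous_proj.continuousAt.eventually (φ.open_source.mem_nhds ht)
  have h1 : ContDiffAt ℝ ∞ (fun s ↦ chartCoord φ (γ s)) t :=
    contDiffAt_of_eventually_hasDerivAt
      ((contDiffAt_hamiltonField hφ (w := chartCoord φ (γ t)) (φ.map_source ht)
        (chartMomentum_ne_zero hφ ht (hγ.norm_eq_one t))).of_le le_top)
      (hsrc.mono fun s hs ↦ hγ.hasDerivAt hφ hs)
  have h2 : ContMDiffAt 𝓘(ℝ, ℝ) (𝓡 2) ∞ (fun s ↦ (chartCoord φ (γ s)).1) t :=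
    (contDiffAt_fst.comp t h1).contMDiffAt
  have h3 : ContMDiffAt (𝓡 2) (𝓡 2) ∞ φ.symm (chartCoord φ (γ t)).1 :=
    ((contMDiffOn_symm_of_mem_maximalAtlas hφ).contMDiffAt
      (φ.open_target.mem_nhds (φ.map_source ht))).of_le le_top
  refine (h3.comp t h2).congr_of_eventuallyEq ?_
  filter_upwards [hsrc] with s hs
  exact (φ.left_inv hs).symm

end AnalyticCurves
end

/-! ### The cosphere as a circle, and the recurrence argument. -/

noncomputable section

open Set Filter Topology

/-- The zeros of a non-zero analytic function on the line are countable. -/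
lemma AnalyticOnNhd.countable_zeros {E : Type*} [NormedAddCommGroup E] [NormedSpace ℝ E]
    {w : ℝ → E} (hw : AnalyticOnNhd ℝ w univ) {x : ℝ} (hx : w x ≠ 0) : {θ | w θ = 0}.Countable := by
  obtain ⟨h1, h2⟩ := mem_codiscrete'.1 (hw.preimage_zero_mem_codiscrete hx)
  have hs : (w ⁻¹' {0}ᶜ)ᶜ = {θ | w θ = 0} := by
    ext θ
    simp
  rw [hs] at h2
  exact (HereditarilyLindelofSpace.isLindelof _).countable_of_isDiscrete h2

section Cosphere

variable {M : Type*} [TopologicalSpace M] [ChartedSpace Plane M] [IsManifold (𝓡 2) ω M]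
  [RiemannianBundle (fun x : M ↦ TangentSpace (𝓡 2) x)]

/-- The Riesz isomorphism between tangent and cotangent vectors. -/
def cotangentRiesz (p : M) : TangentSpace (𝓡 2) p ≃ₗᵢ[ℝ] CotangentSpace p :=
  have : CompleteSpace (TangentSpace (𝓡 2) p) := FiniteDimensional.complete ℝ _
  let e := InnerProductSpace.toDual ℝ (TangentSpace (𝓡 2) p)
  { toFun := fun v ↦ CotangentSpace.ofForm (e v)
    map_add' := e.map_add
    map_smul' := fun c v ↦ e.map_smulₛₗ c v
    invFun := fun ξ ↦ e.symm ξ.toForm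
    left_inv := e.symm_apply_apply
    right_inv := e.apply_symm_apply
    norm_map' := e.norm_map }

/-- An isometry between the plane of complex numbers and a cotangent plane. -/
def cotangentIsometry (p : M) : ℂ ≃ₗᵢ[ℝ] CotangentSpace p :=
  (Complex.orthonormalBasisOneI.equiv ((stdOrthonormalBasis ℝ (TangentSpace (𝓡 2) p)).reindex
    (finCongr (show Module.finrank ℝ (TangentSpace (𝓡 2) p) = 2 from finrank_euclideanSpace_fin)))
    (Equiv.refl _)).trans (cotangentRiesz p)

/-- The parametrization of the unit cosphere by the unit circle. -/
def circleHomeoCosphere (p : M) : Circle ≃ₜ UnitCosphere p where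
  toFun z := ⟨cotangentIsometry p z, by simpa using z.norm_coe⟩
  invFun ξ := ⟨(cotangentIsometry p).symm ξ, by simp [Submonoid.unitSphere]⟩
  left_inv z := Subtype.ext (by simp)
  right_inv ξ := Subtype.ext (by simp)
  continuous_toFun := by
    refine Continuous.subtype_mk ?_ _
    exact (cotangentIsometry p).continuous.comp continuous_subtype_val
  continuous_invFun := by
    refine Continuous.subtype_mk ?_ _
    exact (cotangentIsometry p).symm.continuous.comp continuous_subtype_val

lemma coe_circleHomeoCosphere (p : M) (z : Circle) :
    (circleHomeoCosphere p z : CotangentSpace p) = cotangentIsometry p z := rfl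

lemma circleHomeoCosphere_exp_pi_mul (p : M) (z : Circle) :
    circleHomeoCosphere p (Circle.exp Real.pi * z) = -circleHomeoCosphere p z := by
  refine Subtype.ext ?_
  change cotangentIsometry p (Circle.exp Real.pi * z : Circle) = -cotangentIsometry p z
  rw [Circle.coe_mul, Circle.coe_exp, Complex.exp_pi_mul_I, neg_one_mul, map_neg]

instance (p : M) : SecondCountableTopology (UnitCosphere p) :=
  (circleHomeoCosphere p).symm.isEmbedding.secondCountableTopology

lemma exists_unitCosphere_eq {p : M} {z : CotangentPoint M} (hz : z.proj = p)
    (h1 : ‖z.snd‖ = 1) : ∃ ζ : UnitCosphere p, z = ⟨p, (ζ : CotangentSpace p)⟩ := by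
  obtain ⟨x, ξ⟩ := z
  obtain rfl : x = p := hz
  exact ⟨⟨ξ, by simpa using h1⟩, rfl⟩

lemma unitCosphere_ext_of_mk_eq {p : M} {ξ ζ : UnitCosphere p}
    (h : (⟨p, (ξ : CotangentSpace p)⟩ : CotangentPoint M) = ⟨p, (ζ : CotangentSpace p)⟩) :
    ξ = ζ := by
  rw [TotalSpace.mk_inj] at h
  exact Subtype.ext h

/-- A self-map `f` of a unit cosphere such that `f (-f ξ) = -ξ` and that preserves a probability
measure with an integrable density is an involution, if it maps the circle analytically. -/
theorem sq_eq_id_of_preservesL1Probability {p : M} {f : UnitCosphere p → UnitCosphere p}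
    (hrev : ∀ ξ, f (-f ξ) = -ξ)
    (hf₁ : Continuous fun θ ↦ f (circleHomeoCosphere p (Circle.exp θ)))
    (hf₂ : ContDiff ℝ ω fun θ ↦
      (f (f (circleHomeoCosphere p (Circle.exp θ))) : CotangentSpace p))
    (hpres : PreservesL1Probability p f) : f ∘ f = id := by
  obtain ⟨ρ, hρ0, hρi, hρ1, hpres⟩ := hpres
  set ν := (cosphereMeasure p).withDensity fun ξ ↦ ENNReal.ofReal (ρ ξ) with hν
  have hν1 : ν univ = 1 := by
    rw [hν, withDensity_apply _ MeasurableSet.univ, Measure.restrict_univ,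
      ← ofReal_integral_eq_lintegral_ofReal hρi (Eventually.of_forall hρ0), hρ1, ENNReal.ofReal_one]
  have : IsFiniteMeasure ν := ⟨by rw [hν1]; exact ENNReal.one_lt_top⟩
  let E := circleHomeoCosphere p
  let f' : Circle → Circle := fun z ↦ E.symm (f (E z))
  have hf'c : Continuous f' := by
    refine (Circle.isCoveringMap_exp.isQuotientMap fun z ↦ ⟨_, Circle.exp_arg z⟩).continuous_iff.2 ?_
    exact E.symm.continuous.comp hf₁
  have hf'rev : ∀ z, f' (Circle.exp Real.pi * f' z) = Circle.exp Real.pi * z := by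
    intro z
    refine E.injective ?_
    simp only [f', E, Homeomorph.apply_symm_apply, circleHomeoCosphere_exp_pi_mul, hrev]
  have hsemi : ∀ n : ℕ, ∀ ξ, (f' ∘ f')^[n] (E.symm ξ) = E.symm ((f ∘ f)^[n] ξ) := by
    intro n ξ
    have h : Function.Semiconj E.symm (f ∘ f) (f' ∘ f') := fun ξ ↦ by simp [f']
    exact ((h.iterate_right n) ξ).symm
  have hae : ∀ᵐ ξ ∂ν, f (f ξ) = ξ := by
    -- Poincaré recurrence for `f ∘ f`; second countability of the cosphere gives one null set for
    -- all neighbourhoods.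
    filter_upwards [(hpres.comp hpres).conservative.ae_frequently_mem_of_mem_nhds] with ξ hξ
    have h := circle_sq_fixed_of_recurrent hf'c hf'rev (z := E.symm ξ) (fun s hs ↦ by
      have hs' : E.symm ⁻¹' s ∈ 𝓝 ξ := E.symm.continuous.continuousAt hs
      simp only [hsemi]
      exact hξ _ hs')
    simp only [f', Homeomorph.apply_symm_apply] at h
    exact E.symm.injective h
  -- Otherwise the fixed set, which has full `ν`-measure, is countable by analyticity and hence
  -- `ν`-null.
  by_contra hne
  obtain ⟨x, hx⟩ : ∃ x : ℝ, f (f (E (Circle.exp x))) ≠ E (Circle.exp x) := by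
    by_contra! hall
    refine hne (funext fun ξ ↦ ?_)
    have h := hall (Complex.arg (E.symm ξ))
    rw [Circle.exp_arg, E.apply_symm_apply] at h
    exact h
  have hcount : {θ : ℝ | f (f (E (Circle.exp θ))) = E (Circle.exp θ)}.Countable := by
    let w : ℝ → CotangentSpace p := fun θ ↦
      (f (f (E (Circle.exp θ))) : CotangentSpace p) - cotangentIsometry p (Circle.exp θ)
    have hexp : ContDiff ℝ ω fun θ : ℝ ↦ ((Circle.exp θ : Circle) : ℂ) := by
      simp only [Circle.coe_exp]
      exact (Complex.ofRealCLM.contDiff.mul contDiff_const).cexp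
    have hw : ContDiff ℝ ω w :=
      hf₂.sub ((cotangentIsometry p).toContinuousLinearEquiv.contDiff.comp hexp)
    have hw0 : ∀ θ, w θ = 0 ↔ f (f (E (Circle.exp θ))) = E (Circle.exp θ) := fun θ ↦ by
      rw [sub_eq_zero, ← coe_circleHomeoCosphere, Subtype.ext_iff]
    have hwx : w x ≠ 0 := fun h ↦ hx ((hw0 x).1 h)
    have := AnalyticOnNhd.countable_zeros (fun θ _ ↦ hw.contDiffAt.analyticAt) hwx
    simpa only [hw0] using this
  have hfix : {ξ | f (f ξ) = ξ}.Countable := by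
    refine (hcount.image fun θ ↦ E (Circle.exp θ)).mono fun ξ hξ ↦ ?_
    refine ⟨Complex.arg (E.symm ξ), ?_, ?_⟩
    · change f (f (E (Circle.exp _))) = E (Circle.exp _)
      rwa [Circle.exp_arg, E.apply_symm_apply]
    · change E (Circle.exp _) = ξ
      rw [Circle.exp_arg, E.apply_symm_apply]
  have hμ0 : cosphereMeasure p {ξ | f (f ξ) = ξ} = 0 := by
    have : NullSingletonClass (cosphereMeasure p) :=
      Measure.nullSingletonClass_hausdorff _ one_pos
    exact hfix.measure_zero _
  have hν0 : ν {ξ | f (f ξ) = ξ} = 0 := withDensity_absolutelyContinuous _ _ hμ0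
  have hν0' : ν {ξ | f (f ξ) = ξ}ᶜ = 0 := hae
  have : ν univ = 0 := by
    rw [← union_compl_self {ξ | f (f ξ) = ξ}]
    exact measure_union_null hν0 hν0'
  rw [hν1] at this
  exact one_ne_zero this

end Cosphere
end

/-! ### The first return time and the first return map. -/

noncomputable section

open Set Filter Topology

section FirstReturn

variable {M : Type*} [TopologicalSpace M] [ChartedSpace Plane M] [IsManifold (𝓡 2) ω M]
  [RiemannianBundle (fun x : M ↦ TangentSpace (𝓡 2) x)]
  [IsContMDiffRiemannianBundle (𝓡 2) ω Plane (fun x : M ↦ TangentSpace (𝓡 2) x)]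

/-- Geodesics have non-zero velocity, so they leave their starting point. -/
lemma IsUnitHamiltonOrbit.eventually_proj_ne {γ : ℝ → CotangentPoint M}
    (hγ : IsUnitHamiltonOrbit γ) (t : ℝ) : ∀ᶠ s in 𝓝[≠] t, (γ s).proj ≠ (γ t).proj := by
  let φ := chartAt Plane (γ t).proj
  have hφ : φ ∈ IsManifold.maximalAtlas (𝓡 2) ω M := IsManifold.chart_mem_maximalAtlas _
  have ht : (γ t).proj ∈ φ.source := mem_chart_source _ _
  obtain ⟨⟨v, hv, hr⟩, -⟩ := hγ.hamilton φ hφ t ht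
  set q := chartMomentum φ (γ t)
  set y := φ (γ t).proj
  have hpos : 0 < chartHamiltonian φ y q :=
    chartHamiltonian_pos hφ (φ.map_source ht) (chartMomentum_ne_zero hφ ht (hγ.norm_eq_one t))
  -- Euler's relation: `H` is homogeneous of degree one in `q`, so `q v = H > 0`.
  have hv0 : v ≠ 0 := by
    rintro rfl
    have hd : DifferentiableAt ℝ (fun q ↦ chartHamiltonian φ y q) q :=
      (HasFDerivAt.comp q (((contDiffAt_chartHamiltonian hφ (w := chartCoord φ (γ t))
        (φ.map_source ht) (chartMomentum_ne_zero hφ ht (hγ.norm_eq_one t))).differentiableAt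
        (by simp)).hasFDerivAt) (hasFDerivAt_prodMk_right (𝕜 := ℝ) y q)).differentiableAt
    have h1 : HasDerivAt (fun s : ℝ ↦ s • q) q 1 := by
      simpa using (hasDerivAt_id (1 : ℝ)).smul_const q
    have h2 : HasDerivAt (fun s : ℝ ↦ chartHamiltonian φ y (s • q))
        (fderiv ℝ (fun q ↦ chartHamiltonian φ y q) q q) 1 := by
      have h3 : HasFDerivAt (fun q ↦ chartHamiltonian φ y q)
          (fderiv ℝ (fun q ↦ chartHamiltonian φ y q) q) ((1 : ℝ) • q) := by
        rw [one_smul]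
        exact hd.hasFDerivAt
      exact HasFDerivAt.comp_hasDerivAt (l := fun q ↦ chartHamiltonian φ y q) 1 h3 h1
    have h3 : HasDerivAt (fun s : ℝ ↦ chartHamiltonian φ y (s • q))
        (chartHamiltonian φ y q) 1 := by
      have h4 : HasDerivAt (fun s : ℝ ↦ s * chartHamiltonian φ y q)
          (chartHamiltonian φ y q) 1 := by
        simpa using (hasDerivAt_id (1 : ℝ)).mul_const (chartHamiltonian φ y q)
      refine h4.congr_of_eventuallyEq ?_
      filter_upwards [lt_mem_nhds (show (0 : ℝ) < 1 from one_pos)] with s hs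
      have h5 : chartHamiltonian φ y (s • q) = ‖s‖ * chartHamiltonian φ y q := by
        rw [chartHamiltonian, chartHamiltonian, ContinuousLinearMap.smul_comp]
        exact norm_smul s (CotangentSpace.ofForm (q.comp (chartDifferential φ (φ.symm y))))
      rw [h5, Real.norm_of_nonneg hs.le]
    have h6 := hr q
    rw [map_zero, h2.unique h3] at h6
    exact hpos.ne h6
  filter_upwards [hv.eventually_ne (c := y) hv0] with s hs h
  exact hs (congrArg φ h)

variable [T2Space M]

/-- The return times are given by the orbits, and the first one is attained. -/
theorem isLeast_firstReturnTime {p : M} (hp : IsSelfFocal p)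
    {γ : UnitCosphere p → ℝ → CotangentPoint M} (hγ : ∀ ξ, IsUnitHamiltonOrbit (γ ξ))
    (hγ0 : ∀ ξ, γ ξ 0 = ⟨p, (ξ : CotangentSpace p)⟩) :
    IsLeast (returnTimes p) (firstReturnTime p) := by
  have hmem : ∀ t, t ∈ returnTimes p ↔ 0 < t ∧ ∀ ξ, (γ ξ t).proj = p := by
    refine fun t ↦ and_congr_right fun _ ↦ forall_congr' fun ξ ↦ ⟨?_, fun h ↦ ?_⟩
    · rintro ⟨ζ, δ, hδ, hδ0, hδt⟩
      rw [(hγ ξ).eq_of_eq_at hδ ((hγ0 ξ).trans hδ0.symm), hδt]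
    · obtain ⟨ζ, hζ⟩ := exists_unitCosphere_eq h ((hγ ξ).norm_eq_one t)
      exact ⟨ζ, γ ξ, hγ ξ, hγ0 ξ, hζ⟩
  let ξ₀ : UnitCosphere p := circleHomeoCosphere p 1
  have hne := (hγ ξ₀).eventually_proj_ne 0
  rw [eventually_nhdsWithin_iff] at hne
  obtain ⟨ε, hε, hball⟩ := Metric.eventually_nhds_iff_ball.1 hne
  -- A single orbit already excludes returns before `ε`, so the open condition `0 < t` may be
  -- replaced by the closed one `ε ≤ t`.
  have hset : returnTimes p = Ici ε ∩ ⋂ ξ, {t | (γ ξ t).proj = p} := by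
    ext t
    rw [hmem, mem_inter_iff, mem_iInter]
    refine ⟨fun h ↦ ⟨?_, h.2⟩, fun h ↦ ⟨hε.trans_le h.1, h.2⟩⟩
    by_contra hlt
    rw [mem_Ici, not_le] at hlt
    refine hball t (by simpa [abs_of_pos h.1] using hlt) h.1.ne' ?_
    rw [h.2, hγ0]
  have hbdd : BddBelow (returnTimes p) := ⟨0, fun t ht ↦ ht.1.le⟩
  have hclosed : IsClosed (returnTimes p) := by
    rw [hset]
    exact isClosed_Ici.inter (isClosed_iInter fun ξ ↦
      isClosed_eq (hγ ξ).continuous_proj continuous_const)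
  exact ⟨hclosed.csInf_mem hp hbdd, fun t ht ↦ csInf_le hbdd ht⟩

/-- The directions at time `t` of the orbits that start at `p` and are back at `p` at time `t` form
an analytic curve. -/
theorem contDiff_direction {p : M} {γ : UnitCosphere p → ℝ → CotangentPoint M}
    (hγ : ∀ ξ, IsUnitHamiltonOrbit (γ ξ)) (hγ0 : ∀ ξ, γ ξ 0 = ⟨p, (ξ : CotangentSpace p)⟩)
    {t : ℝ} {g : UnitCosphere p → UnitCosphere p}
    (hg : ∀ ξ, γ ξ t = ⟨p, (g ξ : CotangentSpace p)⟩) :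
    ContDiff ℝ ω fun θ ↦ (g (circleHomeoCosphere p (Circle.exp θ)) : CotangentSpace p) := by
  let E := circleHomeoCosphere p
  have hexp : ContDiff ℝ ω fun θ : ℝ ↦ ((Circle.exp θ : Circle) : ℂ) := by
    simp only [Circle.coe_exp]
    exact (Complex.ofRealCLM.contDiff.mul contDiff_const).cexp
  have hE : ContDiff ℝ ω fun θ : ℝ ↦ (E (Circle.exp θ) : CotangentSpace p).toForm :=
    (cotangentIsometry p).toContinuousLinearEquiv.contDiff.comp hexp
  have h0 : ∀ θ₀, IsAnalyticCurveAt (fun θ ↦ γ (E (Circle.exp θ)) 0) θ₀ := by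
    simp only [hγ0]
    exact IsAnalyticCurveAt.of_fiber (ξ := fun θ ↦ (E (Circle.exp θ) : CotangentSpace p).toForm)
      fun v ↦ hE.clm_apply contDiff_const
  have ht : ∀ θ₀, IsAnalyticCurveAt (fun θ ↦ γ (E (Circle.exp θ)) t) θ₀ := fun θ₀ ↦
    isAnalyticCurveAt_flow (fun θ ↦ hγ _) (h0 θ₀) t
  simp only [hg] at ht
  have hform : ContDiff ℝ ω fun θ : ℝ ↦ (g (E (Circle.exp θ)) : CotangentSpace p).toForm := by
    refine contDiff_clm_apply_iff.2 fun v ↦ contDiff_iff_contDiffAt.2 fun θ₀ ↦ ?_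
    exact (ht θ₀).contDiffAt_fiber (ξ := fun θ ↦ (g (E (Circle.exp θ)) : CotangentSpace p).toForm) v
  exact hform

/-- At a self-focal point whose first return map preserves a probability measure with an integrable
density, the first return map is an involution. -/
theorem firstReturnMap_involutive_and_periodic {p : M} (hp : IsSelfFocal p)
    (hη : PreservesL1Probability p (firstReturnMap p)) :
    IsLeast (returnTimes p) (firstReturnTime p) ∧
    firstReturnMap p ∘ firstReturnMap p = id ∧
    ∀ γ : ℝ → CotangentPoint M, IsUnitHamiltonOrbit γ → (∃ t₀, (γ t₀).proj = p) →
      Function.Periodic γ (2 * firstReturnTime p) := by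
  -- Self-focality itself supplies a global orbit through each unit covector at `p`.
  have hex : ∀ ξ : UnitCosphere p, ∃ γ : ℝ → CotangentPoint M, IsUnitHamiltonOrbit γ ∧
      γ 0 = ⟨p, (ξ : CotangentSpace p)⟩ := by
    intro ξ
    obtain ⟨ℓ, -, h⟩ := hp
    obtain ⟨ζ, γ, hγ, hγ0, -⟩ := h ξ
    exact ⟨γ, hγ, hγ0⟩
  choose γ hγ hγ0 using hex
  have hT := isLeast_firstReturnTime hp hγ hγ0
  set T := firstReturnTime p
  set f := firstReturnMap p
  have hfT : ∀ ξ, γ ξ T = ⟨p, (f ξ : CotangentSpace p)⟩ := by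
    intro ξ
    have h : ∃ ζ, FlowsBack p (firstReturnTime p) ξ ζ := hT.1.2 ξ
    have hfξ : f ξ = h.choose := dif_pos h
    obtain ⟨δ, hδ, hδ0, hδt⟩ := h.choose_spec
    rw [(hγ ξ).eq_of_eq_at hδ ((hγ0 ξ).trans hδ0.symm), hfξ]
    exact hδt
  have hf2T : ∀ ξ, γ ξ (2 * T) = ⟨p, (f (f ξ) : CotangentSpace p)⟩ := by
    intro ξ
    have h := ((hγ ξ).comp_add T).eq_of_eq_at (hγ (f ξ)) (t₀ := 0)
      (by rw [zero_add, hfT, hγ0])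
    rw [← hfT (f ξ), ← h, two_mul]
  have hrev : ∀ ξ, f (-f ξ) = -ξ := by
    intro ξ
    have hneg : ∀ (z : CotangentPoint M) (ζ : UnitCosphere p),
        z = ⟨p, (ζ : CotangentSpace p)⟩ →
          (⟨z.proj, -z.snd⟩ : CotangentPoint M) = ⟨p, ((-ζ : UnitCosphere p) : CotangentSpace p)⟩ := by
      rintro _ ζ rfl
      rfl
    have h0 := hneg (γ ξ (-(0 + -T))) (f ξ) (by rw [zero_add, neg_neg, hfT])
    -- The reversed orbit of `ξ`, started at its time `-T`, leaves `p` in the direction `-f ξ` and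
    -- returns after time `T` in the direction `-ξ`.
    have h := ((hγ ξ).reverse.comp_add (-T)).eq_of_eq_at (hγ (-f ξ)) (t₀ := 0)
      (h0.trans (hγ0 _).symm)
    have h1 := hneg (γ ξ (-(T + -T))) ξ (by rw [add_neg_cancel, neg_zero, hγ0])
    exact unitCosphere_ext_of_mk_eq ((hfT _).symm.trans ((congrFun h T).symm.trans h1))
  have hinv : f ∘ f = id := by
    refine sq_eq_id_of_preservesL1Probability hrev ?_ (contDiff_direction hγ hγ0 hf2T) hη
    exact Continuous.subtype_mk (contDiff_direction hγ hγ0 hfT).continuous _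
  refine ⟨hT, hinv, fun δ hδ ⟨t₀, ht₀⟩ t ↦ ?_⟩
  obtain ⟨ξ, hξ⟩ := exists_unitCosphere_eq ht₀ (hδ.norm_eq_one t₀)
  have h1 := (hδ.comp_add t₀).eq_of_eq_at (hγ ξ) (t₀ := 0) (by rw [zero_add, hξ, hγ0])
  have h2 : δ (2 * T + t₀) = δ t₀ := by
    have h3 : δ (2 * T + t₀) = γ ξ (2 * T) := congrFun h1 (2 * T)
    rw [h3, hf2T, hξ]
    exact congrArg (fun ζ : UnitCosphere p ↦ (⟨p, (ζ : CotangentSpace p)⟩ : CotangentPoint M))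
      (congrFun hinv ξ)
  -- Agreement of `δ` with its shift at the one time `t₀` forces agreement at all times.
  have h4 := (hδ.comp_add (2 * T)).eq_of_eq_at hδ (t₀ := t₀) (by rw [add_comm, h2])
  exact congrFun h4 t

end FirstReturn
end

theorem proposition2 {M : Type*} [TopologicalSpace M] [ChartedSpace Plane M]
    [IsManifold (𝓡 2) ω M]
    [RiemannianBundle (fun x : M ↦ TangentSpace (𝓡 2) x)]
    [IsContMDiffRiemannianBundle (𝓡 2) ω Plane (fun x : M ↦ TangentSpace (𝓡 2) x)]
    (hM : Nonempty (M ≃ₜ Metric.sphere (0 : EuclideanSpace ℝ (Fin 3)) 1))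
    (p : M) (hp : IsSelfFocal p)
    (hη : PreservesL1Probability p (firstReturnMap p)) :
    IsLeast (returnTimes p) (firstReturnTime p) ∧
    firstReturnMap p ∘ firstReturnMap p = id ∧
    ∀ γ : ℝ → CotangentPoint M, IsUnitHamiltonOrbit γ → (∃ t₀, (γ t₀).proj = p) →
      ContMDiff 𝓘(ℝ, ℝ) (𝓡 2) ∞ (fun t ↦ (γ t).proj) ∧
      Function.Periodic γ (2 * firstReturnTime p) := by
  obtain ⟨e⟩ := hM
  -- The Hausdorff property is what uniqueness of orbits requires.
  have : T2Space M := e.symm.t2Space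
  obtain ⟨h1, h2, h3⟩ := firstReturnMap_involutive_and_periodic hp hη
  exact ⟨h1, h2, fun γ hγ h ↦ ⟨hγ.contMDiff_proj, h3 γ hγ h⟩⟩
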